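/- Let $H=\ell^2(\mathbb{N})$ be the real Hilbert space of square-summable sequences. Consider problems with $n$ agents $$\min_{x_1,\dots,x_n\in H}\ \sum_{i=1}^n f_i(x_i)\quad\text{s.t.}\quad A_ix_i=b_i\ (i=1,\dots,n),\qquad x_1=\dots=x_n, \qquad (\ast)$$ where agent $i$ holds $f_i:H\to\mathbb{R}$, a bounded operator $A_i:H\to H$ and $b_i\in H$; put $\mathbf{A}=\mathrm{diag}(A_1,\dots,A_n)$ on $H^n$. A gossip matrix of a graph on $\{1,\dots,n\}$ is a symmetric positive semidefinite matrix $W\in\mathbb{R}^{n\times n}$ with $W_{ij}\neq0$ if and only if $i=j$ or $ij$ is an edge, and with $Wv=0$ if and only if $v_1=\dots=v_n$. $\lambda_{\max}$ and $\lambda_{\min}^+$ denote the largest and the smallest positive eigenvalue (for operators on $H^n$: the largest and the smallest positive point of the spectrum, both of which are required to be eigenvalues). A first-order decentralized algorithm over a sequence of graphs $G(0),G(1),\dots$ maintains local memories $\mathcal{M}_i\subset H$, initially $\mathcal{M}_i=\mathrm{span}\{x_i^0\}$. Each of its steps is of one of three kinds, carried out by all agents simultaneously: a local computation, which replaces $\mathcal{M}_i$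 by $\mathrm{span}\{x,\nabla f_i(x),\nabla f_i^*(x):x\in\mathcal{M}_i\}$, where $f_i^*$ is the convex conjugate of $f_i$; a communication, which replaces $\mathcal{M}_i$ by the span of $\mathcal{M}_i$ and of all $\mathcal{M}_j$ with $ij$ an edge of the current graph, the current graph of the $r$-th communication ($r=0,1,\dots$) being $G(r)$; or a matrix multiplication, which replaces $\mathcal{M}_i$ by $\mathrm{span}\{x,\,b_i,\,A_i^\top b_i,\,A_i^\top A_ix:x\in\mathcal{M}_i\}$. After $k$ steps agent $i$ outputs some $x_i^k\in\mathcal{M}_i$. **Theorem.** For every $\kappa_0>1$ there is a constant $c>0$, depending only on $\kappa_0$, with the following property. Let $\mu_F>0$, $L_F\ge\kappa_0\mu_F$, $\chi_A\ge1$, $\tilde\lambda_{\min}^+>0$ and $\tilde\lambda_{\max}$ be such that $\chi_W:=\tilde\lambda_{\max}/\tilde\lambda_{\min}^+\ge3$. Then there are a number $n$ of agents, a sequence of star graphs $G(k)$ on $\{1,\dots,n\}$ whose centers run cyclically through a fixed set of nodes, and gossip matrices $W(k)$ of $G(k)$ with $\tilde\lambda_{\min}^+\le\lambda_{\min}^+(W(k))\le\lambda_{\max}(W(k))\le\tilde\lambda_{\max}$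 for all $k$, such that for all starting points $x_1^0,\dots,x_n^0\in H$ there is a problem $(\ast)$ in which every $f_i$ is $L_F$-smooth and $\mu_F$-strongly convex, $\lambda_{\max}(\mathbf{A}^\top\mathbf{A})/\lambda_{\min}^+(\mathbf{A}^\top\mathbf{A})=\chi_A$, a solution $x_1=\dots=x_n=x^*$ exists, and, for every $\varepsilon>0$, any first-order decentralized algorithm over $G(0),G(1),\dots$ started from $x_1^0,\dots,x_n^0$ requires, with $N=c\sqrt{L_F/\mu_F}\,\log(1/\varepsilon)$, at least $$N\ \text{local computations},\qquad N\chi_W\ \text{communications},\qquad N\sqrt{\chi_A}\ \text{multiplications by }\mathbf{A}^\top\mathbf{A}$$ to achieve $\|x_i-x^*\|^2\le\varepsilon$ for all $i=1,\dots,n$, where $x_i$ is the output of agent $i$. -/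

import Mathlib

open scoped InnerProductSpace

noncomputable section

namespace DecOpt

/-- The decision space: the real Hilbert space of square-summable sequences (dimension `∞`). -/
abbrev H : Type := lp (fun _ : ℕ => ℝ) 2

/-- `f` is differentiable and `μ`-strongly convex. -/
def StronglyConvex (μ : ℝ) (f : H → ℝ) : Prop :=
  Differentiable ℝ f ∧
    ∀ x y : H, f x + ⟪gradient f x, y - x⟫_ℝ + μ / 2 * ‖y - x‖ ^ 2 ≤ f y

/-- `f` is differentiable and `L`-smooth. -/
def Smooth (L : ℝ) (f : H → ℝ) : Prop :=
  Differentiable ℝ f ∧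
    ∀ x y : H, f y ≤ f x + ⟪gradient f x, y - x⟫_ℝ + L / 2 * ‖y - x‖ ^ 2

/-- The convex (Fenchel) conjugate `f*(y) = sup_x (⟨y, x⟩ - f x)`. It is only used for strongly
convex `f`, for which the supremum is finite and `f*` is differentiable. -/
def conjugate (f : H → ℝ) (y : H) : ℝ := ⨆ x : H, (⟪y, x⟫_ℝ - f x)

/-- The data of a decentralized affine-constrained problem with `n` agents: agent `i` holds the
objective `f i` and the local constraint `A i x = b i`. The constraint operators are bounded and
map `H` to itself, so that `b i` may be stored in the memory of agent `i`. -/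
structure Problem (n : ℕ) where
  f : Fin n → H → ℝ
  A : Fin n → H →L[ℝ] H
  b : Fin n → H

namespace Problem

variable {n : ℕ}

/-- Feasibility of `x = (x_1, …, x_n)`: the local affine constraints and consensus. -/
def Feasible (P : Problem n) (x : Fin n → H) : Prop :=
  (∀ i, P.A i (x i) = P.b i) ∧ ∀ i j, x i = x j

/-- `x` minimizes `∑ i, f i (x i)` over the feasible points. -/
def IsSolution (P : Problem n) (x : Fin n → H) : Prop :=
  P.Feasible x ∧ ∀ y, P.Feasible y → ∑ i, P.f i (x i) ≤ ∑ i, P.f i (y i)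

/-- The block-diagonal operator `𝐀 = diag(A_1, …, A_n)` on the Hilbert sum of `n` copies
of `H`. -/
def blockA (P : Problem n) : PiLp 2 (fun _ : Fin n => H) →L[ℝ] PiLp 2 (fun _ : Fin n => H) :=
  ((PiLp.continuousLinearEquiv 2 ℝ (fun _ : Fin n => H)).symm :
      (Fin n → H) →L[ℝ] PiLp 2 (fun _ : Fin n => H)) ∘L
    ContinuousLinearMap.pi fun i =>
      P.A i ∘L ContinuousLinearMap.proj i ∘L
        ((PiLp.continuousLinearEquiv 2 ℝ (fun _ : Fin n => H)) :
          PiLp 2 (fun _ : Fin n => H) →L[ℝ] (Fin n → H))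

/-- The operator `𝐀ᵀ 𝐀`, as a linear map. -/
def gramA (P : Problem n) : Module.End ℝ (PiLp 2 (fun _ : Fin n => H)) :=
  (ContinuousLinearMap.adjoint P.blockA ∘L P.blockA).toLinearMap

end Problem

/-- `l` is the largest eigenvalue of `T`. The bound ranges over the whole spectrum, which in finite
dimension is the set of eigenvalues. -/
def IsLambdaMax {V : Type*} [AddCommGroup V] [Module ℝ V] (T : Module.End ℝ V) (l : ℝ) : Prop :=
  T.HasEigenvalue l ∧ ∀ t ∈ spectrum ℝ T, t ≤ l

/-- `l` is the smallest positive eigenvalue of `T`. The bound ranges over the whole positive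
spectrum, which in finite dimension is the set of positive eigenvalues. -/
def IsLambdaMinPos {V : Type*} [AddCommGroup V] [Module ℝ V] (T : Module.End ℝ V) (l : ℝ) : Prop :=
  0 < l ∧ T.HasEigenvalue l ∧ ∀ t ∈ spectrum ℝ T, 0 < t → l ≤ t

/-- `W` is a gossip matrix of the undirected graph `G`. -/
structure IsGossipMatrix {n : ℕ} (G : SimpleGraph (Fin n)) (W : Matrix (Fin n) (Fin n) ℝ) :
    Prop where
  posSemidef : W.PosSemidef
  compatible : ∀ i j, W i j ≠ 0 ↔ G.Adj i j ∨ i = j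
  kernel : ∀ v : Fin n → ℝ, W.mulVec v = 0 ↔ ∀ i j, v i = v j

/-- The three kinds of steps of a first-order decentralized algorithm. -/
inductive Action : Type
  | localComputation
  | communication
  | multiplication
  deriving DecidableEq

/-- The number of steps of kind `t` among the first `k` steps. -/
def numSteps (act : ℕ → Action) (t : Action) (k : ℕ) : ℕ := Nat.count (fun j => act j = t) k

section Memory

variable {n : ℕ}

/-- Local computation: every agent adds `∇ f_i x` and `∇ f_i* x` for all `x` in its memory. -/
def localStep (P : Problem n) (M : Fin n → Submodule ℝ H) (i : Fin n) : Submodule ℝ H :=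
  Submodule.span ℝ
    ((M i : Set H) ∪ gradient (P.f i) '' (M i) ∪ gradient (conjugate (P.f i)) '' (M i))

/-- Communication over `G`: every agent receives the memories of its neighbours. -/
def commStep (G : SimpleGraph (Fin n)) (M : Fin n → Submodule ℝ H) (i : Fin n) : Submodule ℝ H :=
  Submodule.span ℝ ((M i : Set H) ∪ ⋃ j ∈ {j | G.Adj i j}, (M j : Set H))

/-- Matrix multiplication: every agent adds `A_iᵀ A_i x` for all `x` in its memory, and the
constraint data `b_i` and `A_iᵀ b_i`. -/
def multStep (P : Problem n) (M : Fin n → Submodule ℝ H) (i : Fin n) : Submodule ℝ H :=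
  Submodule.span ℝ
    ((M i : Set H) ∪ {P.b i, ContinuousLinearMap.adjoint (P.A i) (P.b i)} ∪
      (fun x => ContinuousLinearMap.adjoint (P.A i) (P.A i x)) '' (M i))

/-- The local memories after `k` steps, when step `j` is of kind `act j`, agent `i` starts
from `x0 i`, and the `r`-th communication round (`r = 0, 1, …`) takes place over `G r`. -/
def memory (P : Problem n) (G : ℕ → SimpleGraph (Fin n)) (x0 : Fin n → H) (act : ℕ → Action) :
    ℕ → Fin n → Submodule ℝ H
  | 0 => fun i => Submodule.span ℝ {x0 i}
  | k + 1 =>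
    match act k with
    | .localComputation => localStep P (memory P G x0 act k)
    | .communication =>
        commStep (G (numSteps act .communication k)) (memory P G x0 act k)
    | .multiplication => multStep P (memory P G x0 act k)

/-- `x k i` (the approximate solution of agent `i` after `k` steps) is the output of a first-order
decentralized algorithm with steps `act`: it always lies in the current local memory. -/
def IsExecution (P : Problem n) (G : ℕ → SimpleGraph (Fin n)) (x0 : Fin n → H)
    (act : ℕ → Action) (x : ℕ → Fin n → H) : Prop :=
  ∀ k i, x k i ∈ memory P G x0 act k i

end Memory

end DecOpt

end

open scoped InnerProductSpace

noncomputable section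

namespace DecOpt

/-! ### Spectrum of the star Laplacian -/

section Star

variable {n : ℕ}

/-! The minimizer is built from a geometric sequence whose coordinates can only be discovered one
after the other, each at the full price in all three kinds of steps.

Inside `H` there are mutually orthogonal copies of `H`, orthogonal to all starting points, one for
each vertex `0, …, d` of a path. The common constraint operator is a weighted incidence matrix of
the path, so a feasible point has components `w j • η` with a single `η : H`. Of the `n = 2 s + p`
agents, the first `s` couple the coordinates `2k+1, 2k+2` at vertex `0`, the next `s` couple `2k,
2k+1` at vertex `d`, and the last `p` couple nothing and serve in turn as star centers. The linear
term excites coordinate `0` at vertex `0` only. To get from one coordinate to the next, information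
must cross the whole path (the Gram matrix is tridiagonal: `d` multiplications), change from one
group to the other (through a center, which must receive and later be center again: `p`
communications), and be coupled (one local computation). `memory_hardProblem_le` is this invariant.

On feasible points the optimality condition is a tridiagonal recurrence in the coordinate, solved by
`r ^ (k - 1)` with `(1 - r) ^ 2 = θ r` (`geometric_stationary`, `hardProblem_isSolution`). Both
groups are a fixed fraction of the agents and the path ends carry a fixed fraction of the squared
weights, so `θ` is at most of order `μ / L` and `r = exp (-t)` with `t` at most of order `√(μ / L)`
(`exists_contraction`). An agent that lacks coordinate `m + 1` has squared error at least `exp (-2 t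
m)`.

The conditioning is matched as follows. The star Laplacian has positive eigenvalues in ratio `n`, so
`n = ⌊χW⌋` and `p` is of order `χW`. The path Gram matrix has condition number at most of order `d ^
2`, so `d` may be of order `√χA`; two isolated coordinates make the ratio exactly `χA`
(`exists_pathBounds`, `hardProblem_isLambda`). -/

lemma lapMatrix_starGraph_mulVec_leaf {c i : Fin n} (hi : i ≠ c) (x : Fin n → ℝ) :
    ((SimpleGraph.starGraph c).lapMatrix ℝ).mulVec x i = x i - x c := by
  rw [SimpleGraph.lapMatrix_mulVec_apply]
  have h : (SimpleGraph.starGraph c).neighborFinset i = {c} := by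
    ext j
    simp only [SimpleGraph.mem_neighborFinset, SimpleGraph.starGraph_adj, Finset.mem_singleton]
    constructor
    · rintro ⟨-, h | h⟩
      · exact absurd h hi
      · exact h
    · rintro rfl
      exact ⟨hi, Or.inr rfl⟩
  rw [← SimpleGraph.card_neighborFinset_eq_degree, h]
  simp

lemma lapMatrix_starGraph_mulVec_center (c : Fin n) (x : Fin n → ℝ) :
    ((SimpleGraph.starGraph c).lapMatrix ℝ).mulVec x c = n * x c - ∑ i, x i := by
  rw [SimpleGraph.lapMatrix_mulVec_apply]
  have h : (SimpleGraph.starGraph c).neighborFinset c = Finset.univ.erase c := by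
    ext j
    simp [eq_comm]
  rw [← SimpleGraph.card_neighborFinset_eq_degree, h,
    Finset.card_erase_of_mem (Finset.mem_univ _), Finset.card_univ, Fintype.card_fin,
    Nat.cast_sub (Fin.pos c), ← Finset.add_sum_erase _ _ (Finset.mem_univ c)]
  simp only [Nat.cast_one]
  ring

lemma sum_lapMatrix_starGraph_mulVec (c : Fin n) (x : Fin n → ℝ) :
    ∑ i, ((SimpleGraph.starGraph c).lapMatrix ℝ).mulVec x i = 0 := by
  rw [← Finset.add_sum_erase _ _ (Finset.mem_univ c), lapMatrix_starGraph_mulVec_center,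
    Finset.sum_congr rfl fun i hi =>
      lapMatrix_starGraph_mulVec_leaf (Finset.ne_of_mem_erase hi) x,
    Finset.sum_sub_distrib, ← Finset.add_sum_erase _ _ (Finset.mem_univ c), Finset.sum_const,
    Finset.card_erase_of_mem (Finset.mem_univ _), Finset.card_univ, Fintype.card_fin, nsmul_eq_mul,
    Nat.cast_sub (Fin.pos c)]
  simp only [Nat.cast_one]
  ring

/-- For `t ≠ 0` the entries of `x` sum to zero because the columns of the Laplacian do. The center
row then reads `(t - n) * x c = 0`, and once `x c = 0` a leaf row reads `(t - 1) * x i = 0`. -/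
lemma eigenvalue_lapMatrix_starGraph {c : Fin n} {x : Fin n → ℝ} {t : ℝ} (hx : x ≠ 0)
    (h : ((SimpleGraph.starGraph c).lapMatrix ℝ).mulVec x = t • x) : t = 0 ∨ t = 1 ∨ t = n := by
  by_contra! ht
  obtain ⟨h0, h1, hn⟩ := ht
  have hsum : ∑ i, x i = 0 := by
    have := sum_lapMatrix_starGraph_mulVec c x
    rw [h] at this
    simpa [← Finset.mul_sum, h0] using this
  have hc : x c = 0 := by
    have := lapMatrix_starGraph_mulVec_center c x
    rw [h, hsum, Pi.smul_apply, smul_eq_mul, sub_zero] at this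
    have h2 : (t - n) * x c = 0 := by linarith
    exact (mul_eq_zero.1 h2).resolve_left (sub_ne_zero.2 hn)
  refine hx (funext fun i => ?_)
  rcases eq_or_ne i c with rfl | hi
  · exact hc
  · have := lapMatrix_starGraph_mulVec_leaf hi x
    rw [h, hc, Pi.smul_apply, smul_eq_mul, sub_zero] at this
    have h2 : (t - 1) * x i = 0 := by linarith
    exact (mul_eq_zero.1 h2).resolve_left (sub_ne_zero.2 h1)

/-- The Laplacian of the star graph with center `c`, scaled by `a`. -/
def starGossip (a : ℝ) (c : Fin n) : Matrix (Fin n) (Fin n) ℝ :=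
  a • (SimpleGraph.starGraph c).lapMatrix ℝ

lemma isGossipMatrix_starGossip (hn : 2 ≤ n) {a : ℝ} (ha : 0 < a) (c : Fin n) :
    IsGossipMatrix (SimpleGraph.starGraph c) (starGossip a c) where
  posSemidef := (SimpleGraph.posSemidef_lapMatrix ℝ _).smul ha.le
  compatible i j := by
    have hdeg : (SimpleGraph.starGraph c).degree i ≠ 0 := by
      have : Nontrivial (Fin n) := Fin.nontrivial_iff_two_le.2 hn
      exact ((SimpleGraph.connected_starGraph c).preconnected.degree_pos_of_nontrivial i).ne'
    have key : (SimpleGraph.starGraph c).lapMatrix ℝ i j ≠ 0 ↔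
        (SimpleGraph.starGraph c).Adj i j ∨ i = j := by
      rcases eq_or_ne i j with rfl | hij
      · simpa [SimpleGraph.lapMatrix, SimpleGraph.degMatrix] using hdeg
      · simp only [SimpleGraph.lapMatrix, SimpleGraph.degMatrix, Matrix.sub_apply,
          Matrix.diagonal_apply_ne _ hij, SimpleGraph.adjMatrix_apply]
        simp [hij, -SimpleGraph.starGraph_adj]
    simpa only [starGossip, Matrix.smul_apply, smul_eq_mul, ne_eq, mul_eq_zero, ha.ne',
      false_or] using key
  kernel v := by
    rw [starGossip, Matrix.smul_mulVec, smul_eq_zero_iff_right ha.ne',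
      SimpleGraph.lapMatrix_mulVec_eq_zero_iff_forall_reachable]
    exact ⟨fun h i j => h i j ((SimpleGraph.connected_starGraph c).preconnected i j),
      fun h i j _ => h i j⟩

lemma spectrum_starGossip {a : ℝ} (ha : 0 < a) (c : Fin n) {t : ℝ}
    (ht : t ∈ spectrum ℝ (Matrix.toLin' (starGossip a c))) : t = 0 ∨ t = a ∨ t = n * a := by
  obtain ⟨x, hx, hx0⟩ := (Module.End.hasEigenvalue_iff_mem_spectrum.2 ht).exists_hasEigenvector
  rw [Module.End.mem_eigenspace_iff, Matrix.toLin'_apply, starGossip, Matrix.smul_mulVec] at hx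
  have h : ((SimpleGraph.starGraph c).lapMatrix ℝ).mulVec x = (a⁻¹ * t) • x := by
    rw [mul_smul, ← hx, smul_smul, inv_mul_cancel₀ ha.ne', one_smul]
  rcases eigenvalue_lapMatrix_starGraph hx0 h with h | h | h
  · exact Or.inl (by simpa [ha.ne'] using h)
  · right; left; field_simp at h; exact h
  · right; right; field_simp at h; rw [h]; ring

lemma isLambdaMinPos_starGossip (hn : 3 ≤ n) {a : ℝ} (ha : 0 < a) (c : Fin n) :
    IsLambdaMinPos (Matrix.toLin' (starGossip a c)) a := by
  refine ⟨ha, ?_, fun t ht h0 => ?_⟩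
  · obtain ⟨i, hi⟩ : ∃ i : Fin n, i ≠ c := by
      have : Nontrivial (Fin n) := Fin.nontrivial_iff_two_le.2 (by omega)
      exact exists_ne c
    obtain ⟨j, hj⟩ : ∃ j : Fin n, j ∉ ({c, i} : Finset (Fin n)) := by
      by_contra! h
      have h1 := Finset.card_le_card (fun x _ => h x : Finset.univ ⊆ ({c, i} : Finset (Fin n)))
      have h2 := Finset.card_le_two (a := c) (b := i)
      rw [Finset.card_univ, Fintype.card_fin] at h1
      omega
    simp only [Finset.mem_insert, Finset.mem_singleton, not_or] at hj
    obtain ⟨hjc, hji⟩ := hj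
    set x : Fin n → ℝ := Pi.single i 1 - Pi.single j 1 with hxdef
    have hxc : x c = 0 := by simp [hxdef, hi.symm, Ne.symm hjc]
    refine Module.End.hasEigenvalue_of_hasEigenvector (x := x) ⟨?_, fun h => ?_⟩
    · rw [Module.End.mem_eigenspace_iff, Matrix.toLin'_apply, starGossip, Matrix.smul_mulVec]
      congr 1
      ext k
      rcases eq_or_ne k c with rfl | hk
      · rw [lapMatrix_starGraph_mulVec_center, hxc]
        simp [hxdef]
      · rw [lapMatrix_starGraph_mulVec_leaf hk, hxc, sub_zero]
    · simpa [hxdef, Ne.symm hji] using congrFun h i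
  · have : (1 : ℝ) ≤ n := by exact_mod_cast (by omega : 1 ≤ n)
    rcases spectrum_starGossip ha c ht with h | h | h
    · exact absurd h h0.ne'
    · exact h.ge
    · rw [h]; nlinarith

lemma isLambdaMax_starGossip (hn : 2 ≤ n) {a : ℝ} (ha : 0 < a) (c : Fin n) :
    IsLambdaMax (Matrix.toLin' (starGossip a c)) (n * a) := by
  have hn1 : (1 : ℝ) < n := by exact_mod_cast (by omega : 1 < n)
  refine ⟨?_, fun t ht => ?_⟩
  · set x : Fin n → ℝ := fun i => (if i = c then (n : ℝ) else 0) - 1 with hxdef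
    have hxc : x c = n - 1 := by simp [hxdef]
    refine Module.End.hasEigenvalue_of_hasEigenvector (x := x) ⟨?_, fun h => ?_⟩
    · rw [Module.End.mem_eigenspace_iff, Matrix.toLin'_apply, starGossip, Matrix.smul_mulVec,
        mul_comm, mul_smul]
      congr 1
      ext k
      rcases eq_or_ne k c with rfl | hk
      · rw [lapMatrix_starGraph_mulVec_center]
        simp [hxdef]
      · rw [lapMatrix_starGraph_mulVec_leaf hk, hxc]
        simp only [hxdef, hk, if_false, Pi.smul_apply, smul_eq_mul]
        ring
    · have := congrFun h c
      rw [hxc, Pi.zero_apply] at this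
      linarith
  · rcases spectrum_starGossip ha c ht with h | h | h
    · rw [h]; positivity
    · rw [h]; nlinarith
    · exact h.le

end Star

/-! ### Quadratic objectives and their conjugates -/

section Quadratic

/-- The quadratic function `x ↦ ⟪Q x, x⟫ / 2 - ⟪q, x⟫`. -/
def quadratic (Q : H →L[ℝ] H) (q : H) (x : H) : ℝ := ⟪Q x, x⟫_ℝ / 2 - ⟪q, x⟫_ℝ

lemma quadratic_expand {Q : H →L[ℝ] H} (hQ : ∀ x y, ⟪Q x, y⟫_ℝ = ⟪x, Q y⟫_ℝ) (q x y : H) :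
    quadratic Q q y = quadratic Q q x + ⟪Q x - q, y - x⟫_ℝ + ⟪Q (y - x), y - x⟫_ℝ / 2 := by
  have h : ⟪Q y, x⟫_ℝ = ⟪Q x, y⟫_ℝ := by rw [hQ y x, real_inner_comm]
  simp only [quadratic, map_sub, inner_sub_left, inner_sub_right]
  linarith

lemma hasGradientAt_quadratic {Q : H →L[ℝ] H} (hQ : ∀ x y, ⟪Q x, y⟫_ℝ = ⟪x, Q y⟫_ℝ) (q x : H) :
    HasGradientAt (quadratic Q q) (Q x - q) x := by
  rw [hasGradientAt_iff_hasFDerivAt]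
  have h1 : HasFDerivAt (fun x : H => ⟪Q x, x⟫_ℝ)
      ((fderivInnerCLM ℝ (Q x, x)).comp (Q.prod (ContinuousLinearMap.id ℝ H))) x :=
    HasFDerivAt.inner ℝ Q.hasFDerivAt (hasFDerivAt_id x)
  have h2 : HasFDerivAt (fun x : H => ⟪q, x⟫_ℝ) (innerSL ℝ q) x := (innerSL ℝ q).hasFDerivAt
  have h3 : quadratic Q q = fun x => ⟪Q x, x⟫_ℝ * 2⁻¹ - ⟪q, x⟫_ℝ := by
    ext x
    rw [quadratic, div_eq_mul_inv]
  rw [h3]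
  refine ((h1.mul_const (2⁻¹ : ℝ)).sub h2).congr_fderiv ?_
  ext y
  have h4 : ⟪Q y, x⟫_ℝ = ⟪Q x, y⟫_ℝ := by rw [hQ y x, real_inner_comm]
  simp [fderivInnerCLM_apply, h4]
  ring

lemma gradient_quadratic {Q : H →L[ℝ] H} (hQ : ∀ x y, ⟪Q x, y⟫_ℝ = ⟪x, Q y⟫_ℝ) (q x : H) :
    gradient (quadratic Q q) x = Q x - q :=
  (hasGradientAt_quadratic hQ q x).gradient

lemma stronglyConvex_quadratic {Q : H →L[ℝ] H} (hQ : ∀ x y, ⟪Q x, y⟫_ℝ = ⟪x, Q y⟫_ℝ) (q : H)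
    {μ : ℝ} (hμ : ∀ x, μ * ‖x‖ ^ 2 ≤ ⟪Q x, x⟫_ℝ) : StronglyConvex μ (quadratic Q q) := by
  refine ⟨fun x => (hasGradientAt_quadratic hQ q x).differentiableAt, fun x y => ?_⟩
  rw [gradient_quadratic hQ, quadratic_expand hQ q x y]
  linarith [hμ (y - x)]

lemma smooth_quadratic {Q : H →L[ℝ] H} (hQ : ∀ x y, ⟪Q x, y⟫_ℝ = ⟪x, Q y⟫_ℝ) (q : H)
    {L : ℝ} (hL : ∀ x, ⟪Q x, x⟫_ℝ ≤ L * ‖x‖ ^ 2) : Smooth L (quadratic Q q) := by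
  refine ⟨fun x => (hasGradientAt_quadratic hQ q x).differentiableAt, fun x y => ?_⟩
  rw [gradient_quadratic hQ, quadratic_expand hQ q x y]
  linarith [hL (y - x)]

/-- Completing the square around the maximizer `R (y + q)`. -/
lemma conjugate_quadratic {Q R : H →L[ℝ] H} (hQ : ∀ x y, ⟪Q x, y⟫_ℝ = ⟪x, Q y⟫_ℝ)
    (hpos : ∀ x, 0 ≤ ⟪Q x, x⟫_ℝ) (hQR : ∀ x, Q (R x) = x) (q y : H) :
    conjugate (quadratic Q q) y = ⟪R (y + q), y + q⟫_ℝ / 2 := by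
  have key : ∀ x, ⟪y, x⟫_ℝ - quadratic Q q x =
      ⟪R (y + q), y + q⟫_ℝ / 2 - ⟪Q (x - R (y + q)), x - R (y + q)⟫_ℝ / 2 := by
    intro x
    have h := quadratic_expand hQ (y + q) (R (y + q)) x
    rw [hQR, sub_self, inner_zero_left] at h
    simp only [quadratic, hQR, inner_add_left] at h ⊢
    simp only [inner_add_right, real_inner_comm _ y, real_inner_comm _ q] at h ⊢
    linarith
  refine le_antisymm (ciSup_le fun x => ?_) ?_
  · rw [key]
    linarith [hpos (x - R (y + q))]
  · refine le_ciSup_of_le ⟨⟪R (y + q), y + q⟫_ℝ / 2, ?_⟩ (R (y + q)) ?_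
    · rintro _ ⟨x, rfl⟩
      simp only [key]
      linarith [hpos (x - R (y + q))]
    · rw [key]
      simp

lemma gradient_conjugate_quadratic {Q R : H →L[ℝ] H} (hQ : ∀ x y, ⟪Q x, y⟫_ℝ = ⟪x, Q y⟫_ℝ)
    (hR : ∀ x y, ⟪R x, y⟫_ℝ = ⟪x, R y⟫_ℝ)
    (hpos : ∀ x, 0 ≤ ⟪Q x, x⟫_ℝ) (hQR : ∀ x, Q (R x) = x) (q y : H) :
    gradient (conjugate (quadratic Q q)) y = R (y + q) := by
  have h : conjugate (quadratic Q q) =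
      fun y => quadratic R (-R q) y + ⟪R q, q⟫_ℝ / 2 := by
    ext y
    rw [conjugate_quadratic hQ hpos hQR, quadratic]
    simp only [map_add, inner_add_left, inner_add_right, inner_neg_left]
    rw [hR y q, real_inner_comm y (R q)]
    ring
  rw [h, HasGradientAt.gradient (f' := R y - -R q)]
  · simp
  · have := (hasGradientAt_quadratic hR (-R q) y)
    rw [hasGradientAt_iff_hasFDerivAt] at this ⊢
    exact this.add_const _

/-- `μ + (L - μ) T`, a Hessian with the two eigenvalues `μ` and `L` if `T` is a projection. -/
def hessian (μ L : ℝ) (T : H →L[ℝ] H) : H →L[ℝ] H := μ • 1 + (L - μ) • T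

variable {μ L : ℝ} {T : H →L[ℝ] H}

lemma hessian_apply (x : H) : hessian μ L T x = μ • x + (L - μ) • T x := rfl

lemma hessian_symm (hs : ∀ x y, ⟪T x, y⟫_ℝ = ⟪x, T y⟫_ℝ) (x y : H) :
    ⟪hessian μ L T x, y⟫_ℝ = ⟪x, hessian μ L T y⟫_ℝ := by
  simp only [hessian_apply, inner_add_left, inner_add_right, real_inner_smul_left,
    real_inner_smul_right, hs]

lemma inner_proj_self (hs : ∀ x y, ⟪T x, y⟫_ℝ = ⟪x, T y⟫_ℝ) (hi : ∀ x, T (T x) = T x) (x : H) :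
    ⟪T x, x⟫_ℝ = ‖T x‖ ^ 2 := by
  rw [← real_inner_self_eq_norm_sq, hs x (T x), hi, real_inner_comm]

lemma norm_proj_sq_le (hs : ∀ x y, ⟪T x, y⟫_ℝ = ⟪x, T y⟫_ℝ) (hi : ∀ x, T (T x) = T x) (x : H) :
    ‖T x‖ ^ 2 ≤ ‖x‖ ^ 2 := by
  have h := inner_proj_self hs hi x
  have := norm_sub_sq_real (T x) x
  nlinarith [sq_nonneg ‖T x - x‖]

lemma hessian_inner_le (hs : ∀ x y, ⟪T x, y⟫_ℝ = ⟪x, T y⟫_ℝ) (hi : ∀ x, T (T x) = T x)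
    (hμL : μ ≤ L) (x : H) : ⟪hessian μ L T x, x⟫_ℝ ≤ L * ‖x‖ ^ 2 := by
  rw [hessian_apply, inner_add_left, real_inner_smul_left, real_inner_smul_left,
    inner_proj_self hs hi, real_inner_self_eq_norm_sq]
  nlinarith [norm_proj_sq_le hs hi x]

lemma le_hessian_inner (hs : ∀ x y, ⟪T x, y⟫_ℝ = ⟪x, T y⟫_ℝ) (hi : ∀ x, T (T x) = T x)
    (hμL : μ ≤ L) (x : H) : μ * ‖x‖ ^ 2 ≤ ⟪hessian μ L T x, x⟫_ℝ := by
  rw [hessian_apply, inner_add_left, real_inner_smul_left, real_inner_smul_left,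
    inner_proj_self hs hi, real_inner_self_eq_norm_sq]
  nlinarith [sq_nonneg ‖T x‖]

/-- Since `T` is a projection, the inverse is affine in the same `T`. The gradient of the conjugate
therefore couples no more coordinates than the gradient itself, and the dual oracle gives no
advantage. -/
lemma hessian_hessian_inv (hi : ∀ x, T (T x) = T x) (hμ : μ ≠ 0) (hL : L ≠ 0) (x : H) :
    hessian μ L T (hessian μ⁻¹ L⁻¹ T x) = x := by
  simp only [hessian_apply, map_add, map_smul, hi, smul_add, smul_smul]
  rw [inv_mul_cancel₀ hμ, one_smul, add_assoc, ← add_smul, ← add_smul]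
  convert add_zero x using 2
  convert zero_smul ℝ _ using 2
  field_simp
  ring

end Quadratic

/-! ### Finite matrices acting on orthogonal copies of the space -/

section MatrixOperator

variable {R ι κ ν : Type*} [Ring R] [StarRing R] [Algebra ℝ R] [StarModule ℝ R]
  [Fintype ι] [Fintype κ] [Fintype ν] [DecidableEq ι] [DecidableEq κ]

/-- `V` consists of isometries with mutually orthogonal ranges. -/
def IsometricFamily (V : ι → R) : Prop := ∀ i j, star (V i) * V j = if i = j then 1 else 0

/-- The operator `∑ M i j • U i (V j)*` with matrix `M` in the families `V` and `U`. -/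
def matrixOp (U : ι → R) (V : κ → R) (M : Matrix ι κ ℝ) : R :=
  ∑ i, ∑ j, M i j • (U i * star (V j))

omit [DecidableEq ι] [DecidableEq κ] in
lemma star_matrixOp (U : ι → R) (V : κ → R) (M : Matrix ι κ ℝ) :
    star (matrixOp U V M) = matrixOp V U M.transpose := by
  simp only [matrixOp, star_sum, star_smul, star_mul, star_star, star_trivial,
    Matrix.transpose_apply]
  exact Finset.sum_comm

omit [DecidableEq κ] [StarModule ℝ R] in
lemma matrixOp_mul {U : ι → R} (hU : IsometricFamily U) (V : κ → R) (X : ν → R)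
    (M : Matrix κ ι ℝ) (N : Matrix ι ν ℝ) :
    matrixOp V U M * matrixOp U X N = matrixOp V X (M * N) := by
  have h : ∀ i j k l, M i j • (V i * star (U j)) * N k l • (U k * star (X l)) =
      if j = k then (M i j * N k l) • (V i * star (X l)) else 0 := by
    intro i j k l
    rw [smul_mul_smul_comm, mul_assoc, ← mul_assoc (star (U j)), hU j k]
    split_ifs <;> simp
  have h' : ∀ i j, M i j • (V i * star (U j)) * matrixOp U X N =
      ∑ l, (M i j * N j l) • (V i * star (X l)) := by
    intro i j
    simp only [matrixOp, Finset.mul_sum, h]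
    rw [Finset.sum_comm]
    simp
  rw [show matrixOp V X (M * N) = ∑ i, ∑ l, (M * N) i l • (V i * star (X l)) from rfl,
    show matrixOp V U M = ∑ i, ∑ j, M i j • (V i * star (U j)) from rfl, Finset.sum_mul]
  refine Finset.sum_congr rfl fun i _ => ?_
  simp only [Finset.sum_mul, h', Matrix.mul_apply, Finset.sum_smul]
  exact Finset.sum_comm

omit [DecidableEq κ] [StarModule ℝ R] in
lemma matrixOp_mul_apply {V : ι → R} (hV : IsometricFamily V) (U : κ → R)
    (M : Matrix κ ι ℝ) (j : ι) : matrixOp U V M * V j = ∑ i, M i j • U i := by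
  have h : ∀ i k, M i k • (U i * star (V k)) * V j = if k = j then M i k • U i else 0 := by
    intro i k
    rw [smul_mul_assoc, mul_assoc, hV k j]
    split_ifs <;> simp
  simp only [matrixOp, Finset.sum_mul, h, Finset.sum_ite_eq', Finset.mem_univ, if_true]

omit [StarModule ℝ R] in
-- The resolvent is explicit: `matrixOp V V 1` is the projection onto the joint range of the family,
-- on which the matrix resolvent acts, while `t⁻¹` inverts on the complement.
lemma notMem_spectrum_matrixOp {V : ι → R} (hV : IsometricFamily V) {M : Matrix ι ι ℝ} {t : ℝ}
    (ht : t ≠ 0) (hM : t ∉ spectrum ℝ M) : t ∉ spectrum ℝ (matrixOp V V M) := by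
  rw [spectrum.notMem_iff] at hM ⊢
  obtain ⟨N, hMN, hNM⟩ := isUnit_iff_exists.1 hM
  have hsub : ∀ M N : Matrix ι ι ℝ, matrixOp V V (M - N) = matrixOp V V M - matrixOp V V N := by
    intro M N
    simp only [matrixOp, Matrix.sub_apply, sub_smul, Finset.sum_sub_distrib]
  have hsmul : ∀ (c : ℝ) (M : Matrix ι ι ℝ), matrixOp V V (c • M) = c • matrixOp V V M := by
    intro c M
    simp only [matrixOp, Matrix.smul_apply, Finset.smul_sum, smul_smul, smul_eq_mul]
  rw [Algebra.algebraMap_eq_smul_one] at hMN hNM ⊢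
  have h1 : t • matrixOp V V N - matrixOp V V M * matrixOp V V N = matrixOp V V 1 := by
    rw [matrixOp_mul hV, ← hsmul, ← hsub, ← hMN, sub_mul, smul_mul_assoc, one_mul]
  have h2 : t • matrixOp V V N - matrixOp V V N * matrixOp V V M = matrixOp V V 1 := by
    rw [matrixOp_mul hV, ← hsmul, ← hsub, ← hNM, mul_sub, mul_smul_comm, mul_one]
  have h3 : matrixOp V V M * matrixOp V V 1 = matrixOp V V M := by
    rw [matrixOp_mul hV, mul_one]
  have h4 : matrixOp V V 1 * matrixOp V V M = matrixOp V V M := by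
    rw [matrixOp_mul hV, one_mul]
  refine isUnit_iff_exists.2 ⟨matrixOp V V N + t⁻¹ • (1 - matrixOp V V 1), ?_, ?_⟩
  · rw [sub_mul, mul_add, mul_add, smul_one_mul, smul_one_mul, smul_smul, mul_inv_cancel₀ ht,
      one_smul, mul_smul_comm, mul_sub, mul_one, h3, sub_self, smul_zero, add_zero,
      ← sub_add_eq_add_sub, h1]
    abel
  · rw [mul_sub, add_mul, add_mul, mul_smul_one, mul_smul_one, smul_smul, mul_inv_cancel₀ ht,
      one_smul, smul_mul_assoc, sub_mul, one_mul, h4, sub_self, smul_zero, add_zero,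
      ← sub_add_eq_add_sub, h2]
    abel

end MatrixOperator

/-! ### The weighted path and its Poincaré inequality -/

section Path

/-- The weights `√d, 1, …, 1, √d` of the vertices of a path. -/
def pathWeight (d : ℕ) (j : Fin (d + 1)) : ℝ := if j = 0 ∨ j = Fin.last d then √d else 1

/-- The weighted incidence matrix of a path. -/
def pathMatrix (d : ℕ) : Matrix (Fin d) (Fin (d + 1)) ℝ := Matrix.of fun i j =>
  (if j = i.castSucc then (pathWeight d j)⁻¹ else 0) - if j = i.succ then (pathWeight d j)⁻¹ else 0

variable {d : ℕ}

lemma one_le_pathWeight (hd : 1 ≤ d) (j : Fin (d + 1)) : 1 ≤ pathWeight d j := by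
  unfold pathWeight
  split_ifs
  · exact Real.one_le_sqrt.2 (by exact_mod_cast hd)
  · exact le_rfl

lemma pathWeight_zero : pathWeight d 0 = √d := by simp [pathWeight]

lemma pathWeight_last : pathWeight d (Fin.last d) = √d := by simp [pathWeight]

lemma pathMatrix_mulVec (x : Fin (d + 1) → ℝ) (i : Fin d) : (pathMatrix d).mulVec x i =
    x i.castSucc / pathWeight d i.castSucc - x i.succ / pathWeight d i.succ := by
  simp [Matrix.mulVec, dotProduct, pathMatrix, sub_mul, Finset.sum_sub_distrib, div_eq_inv_mul]

lemma pathMatrix_mulVec_pathWeight (hd : 1 ≤ d) :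
    (pathMatrix d).mulVec (pathWeight d) = 0 := by
  ext i
  have h := fun j => (zero_lt_one.trans_le (one_le_pathWeight hd j)).ne'
  rw [pathMatrix_mulVec, div_self (h _), div_self (h _), sub_self, Pi.zero_apply]

/-- Each end contributes `d`, hence at least a third of the total. This is the purpose of the
weights: the couplings sit at the ends only, and their strength relative to the whole path does not
degrade with `d`. -/
lemma sum_pathWeight_sq_le (hd : 1 ≤ d) : ∑ j, pathWeight d j ^ 2 ≤ 3 * d := by
  have hd' : (1 : ℝ) ≤ d := by exact_mod_cast hd
  have h : ∀ j, pathWeight d j ^ 2 ≤ 1 + (if j = 0 then (d - 1 : ℝ) else 0) +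
      if j = Fin.last d then (d - 1 : ℝ) else 0 := by
    intro j
    unfold pathWeight
    split_ifs <;> simp_all
  refine (Finset.sum_le_sum fun j _ => h j).trans ?_
  simp only [Finset.sum_add_distrib, Finset.sum_const, Finset.card_univ, Fintype.card_fin,
    Finset.sum_ite_eq', Finset.mem_univ, if_true, nsmul_eq_mul]
  push_cast
  linarith

lemma abs_sub_zero_le_sum : ∀ {d : ℕ} (y : Fin (d + 1) → ℝ) (j : Fin (d + 1)),
    |y j - y 0| ≤ ∑ i : Fin d, |y i.castSucc - y i.succ|
  | 0, y, j => by simp [Fin.fin_one_eq_zero j]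
  | d + 1, y, j => by
    have ih := abs_sub_zero_le_sum (fun i : Fin (d + 1) => y i.castSucc)
    rw [Fin.sum_univ_castSucc]
    induction j using Fin.lastCases with
    | last =>
      have h1 := ih (Fin.last d)
      have h2 := abs_sub_le (y (Fin.last (d + 1))) (y (Fin.last d).castSucc) (y 0)
      rw [abs_sub_comm (y (Fin.last (d + 1))) (y (Fin.last d).castSucc)] at h2
      simp only [Fin.castSucc_zero, Fin.succ_last, Fin.succ_castSucc] at *
      linarith
    | cast j =>
      have h1 := ih j
      simp only [Fin.castSucc_zero, Fin.succ_last, Fin.succ_castSucc] at *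
      linarith [abs_nonneg (y (Fin.last d).castSucc - y (Fin.last (d + 1)))]

lemma sq_sub_zero_le_sum (y : Fin (d + 1) → ℝ) (j : Fin (d + 1)) :
    (y j - y 0) ^ 2 ≤ d * ∑ i : Fin d, (y i.castSucc - y i.succ) ^ 2 := by
  rw [← sq_abs]
  refine (pow_le_pow_left₀ (abs_nonneg _) (abs_sub_zero_le_sum y j) 2).trans ?_
  simpa using sq_sum_le_card_mul_sum_sq (s := Finset.univ)
    (f := fun i : Fin d => |y i.castSucc - y i.succ|)

lemma pathMatrix_upper (hd : 1 ≤ d) (x : Fin (d + 1) → ℝ) :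
    ∑ i, (pathMatrix d).mulVec x i ^ 2 ≤ 4 * ∑ j, x j ^ 2 := by
  have h1 : ∀ j, (x j / pathWeight d j) ^ 2 ≤ x j ^ 2 := by
    intro j
    rw [div_pow]
    exact div_le_self (sq_nonneg _) (one_le_pow₀ (one_le_pathWeight hd j))
  have h2 : ∀ i, (pathMatrix d).mulVec x i ^ 2 ≤ 2 * x i.castSucc ^ 2 + 2 * x i.succ ^ 2 := by
    intro i
    rw [pathMatrix_mulVec]
    nlinarith [h1 i.castSucc, h1 i.succ,
      sq_nonneg (x i.castSucc / pathWeight d i.castSucc + x i.succ / pathWeight d i.succ)]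
  refine (Finset.sum_le_sum fun i _ => h2 i).trans ?_
  rw [Finset.sum_add_distrib, ← Finset.mul_sum, ← Finset.mul_sum]
  have h3 := Fin.sum_univ_castSucc (fun j => x j ^ 2)
  have h4 := Fin.sum_univ_succ (fun j => x j ^ 2)
  nlinarith [sq_nonneg (x 0), sq_nonneg (x (Fin.last d))]

/-- With `y = x / w`, the function `y` has mean zero for the weights `w ^ 2`, so its variance is at
most the second moment about `y 0`. The latter is controlled by Cauchy–Schwarz along the path and by
the total weight `3 d`. -/
lemma pathMatrix_lower (hd : 1 ≤ d) (x : Fin (d + 1) → ℝ) (hx : ∑ j, pathWeight d j * x j = 0) :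
    ∑ j, x j ^ 2 ≤ 3 * d ^ 2 * ∑ i, (pathMatrix d).mulVec x i ^ 2 := by
  set w := pathWeight d with hw
  have hw0 : ∀ j, w j ≠ 0 := fun j => (zero_lt_one.trans_le (one_le_pathWeight hd j)).ne'
  set y : Fin (d + 1) → ℝ := fun j => x j / w j with hy
  set D := ∑ i, (pathMatrix d).mulVec x i ^ 2 with hD
  have hDy : D = ∑ i : Fin d, (y i.castSucc - y i.succ) ^ 2 := by
    simp only [hD, pathMatrix_mulVec, hy, hw]
  have hD0 : 0 ≤ D := Finset.sum_nonneg fun i _ => sq_nonneg _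
  -- Expansion of `w j ^ 2 * (y j - y 0) ^ 2`; the last term cancels on summation by `hx`.
  have h1 : ∀ j, x j ^ 2 ≤ w j ^ 2 * (d * D) + 2 * y 0 * (w j * x j) := by
    intro j
    have h2 := mul_le_mul_of_nonneg_left (sq_sub_zero_le_sum y j) (sq_nonneg (w j))
    rw [← hDy] at h2
    have h3 : x j = w j * y j := by simp only [hy]; field_simp [hw0 j]
    rw [h3]
    nlinarith [sq_nonneg (w j * y 0)]
  calc ∑ j, x j ^ 2 ≤ ∑ j, (w j ^ 2 * (d * D) + 2 * y 0 * (w j * x j)) :=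
        Finset.sum_le_sum fun j _ => h1 j
    _ = (∑ j, w j ^ 2) * (d * D) := by
        rw [Finset.sum_add_distrib, ← Finset.mul_sum, hx, mul_zero, add_zero, Finset.sum_mul]
    _ ≤ 3 * d * (d * D) := by
        gcongr
        exact sum_pathWeight_sq_le hd
    _ = 3 * d ^ 2 * D := by ring

/-- The path of length `d` satisfies its weighted Poincaré inequalities with constants `l₁`
and `l₂`. -/
def PathBounds (d : ℕ) (l₁ l₂ : ℝ) : Prop := ∀ x : Fin (d + 1) → ℝ,
  ∑ i, (pathMatrix d).mulVec x i ^ 2 ≤ l₂ * ∑ j, x j ^ 2 ∧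
    (∑ j, pathWeight d j * x j = 0 → l₁ * ∑ j, x j ^ 2 ≤ ∑ i, (pathMatrix d).mulVec x i ^ 2)

/-- The path spectrum only has to lie between `l₁` and `l₂`, so their ratio can be prescribed
exactly; the isolated coordinates of `constraintMatrix` attain both values. -/
lemma exists_pathBounds {χ : ℝ} (hχ : 1 ≤ χ) : ∃ (d : ℕ) (l₁ l₂ : ℝ),
    1 ≤ d ∧ √χ ≤ 7 * d ∧ 0 < l₁ ∧ l₂ / l₁ = χ ∧ PathBounds d l₁ l₂ := by
  rcases lt_or_ge χ 48 with h | h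
  -- A single edge with unit weights has Gram eigenvalues `0` and `2`, and `√48 ≤ 7`.
  · refine ⟨1, 2, 2 * χ, le_rfl, ?_, two_pos, by field_simp, fun x => ?_⟩
    · rw [Real.sqrt_le_left (by norm_num)]
      norm_num
      linarith
    · have h1 : pathWeight 1 0 = 1 := by simp [pathWeight]
      have h2 : pathWeight 1 1 = 1 := by simp [pathWeight]
      have hs : ∀ f : Fin (1 + 1) → ℝ, ∑ j, f j = f 0 + f 1 := Fin.sum_univ_two
      simp only [hs, Finset.univ_unique, Finset.sum_singleton, pathMatrix_mulVec,
        Fin.default_eq_zero, Fin.castSucc_zero, Fin.succ_zero_eq_one, h1, h2]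
      constructor
      · nlinarith [sq_nonneg (x 0 + x 1), sq_nonneg (x 0), sq_nonneg (x 1)]
      · intro h3
        have : x 1 = -x 0 := by linarith
        rw [this]
        nlinarith
  -- The general bounds `4` and `1 / (3 d ^ 2)` have ratio `12 d ^ 2`, which must not exceed `χ`.
  -- The threshold `48` gives `d ≥ 2`, so rounding down costs only a constant factor.
  · have h0 : 2 ≤ √(χ / 12) := Real.le_sqrt_of_sq_le (by linarith)
    set d := ⌊√(χ / 12)⌋₊ with hd
    have hd2 : 2 ≤ d := Nat.le_floor (by exact_mod_cast h0)
    have hd2' : (2 : ℝ) ≤ d := by exact_mod_cast hd2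
    have hle : (d : ℝ) ≤ √(χ / 12) := Nat.floor_le (by positivity)
    have hlt : √(χ / 12) < d + 1 := Nat.lt_floor_add_one _
    have hsq : √(χ / 12) ^ 2 = χ / 12 := Real.sq_sqrt (by linarith)
    have hd1 : 1 ≤ d := by omega
    refine ⟨d, 1 / (3 * d ^ 2), χ / (3 * d ^ 2), hd1, ?_, by positivity, by field_simp,
      fun x => ⟨?_, fun hx => ?_⟩⟩
    · rw [Real.sqrt_le_left (by positivity)]
      nlinarith
    · refine (pathMatrix_upper hd1 x).trans ?_
      refine mul_le_mul_of_nonneg_right ?_ (Finset.sum_nonneg fun i _ => sq_nonneg _)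
      rw [le_div_iff₀ (by positivity)]
      nlinarith
    · rw [div_mul_eq_mul_div, one_mul, div_le_iff₀ (by positivity), mul_comm]
      exact pathMatrix_lower hd1 x hx

/-- The constraint matrix: a weighted path together with two isolated coordinates, whose Gram
matrix has the eigenvalues `l₁` and `l₂`. -/
def constraintMatrix (d : ℕ) (l₁ l₂ : ℝ) : Matrix (Fin d ⊕ Fin 2) (Fin (d + 1) ⊕ Fin 2) ℝ :=
  Matrix.fromBlocks (pathMatrix d) 0 0 (Matrix.diagonal ![√l₁, √l₂])

lemma gram_constraintMatrix {l₁ l₂ : ℝ} (h₁ : 0 ≤ l₁) (h₂ : 0 ≤ l₂) :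
    (constraintMatrix d l₁ l₂).transpose * constraintMatrix d l₁ l₂ =
      Matrix.fromBlocks ((pathMatrix d).transpose * pathMatrix d) 0 0
        (Matrix.diagonal ![l₁, l₂]) := by
  rw [constraintMatrix, Matrix.fromBlocks_transpose, Matrix.fromBlocks_multiply,
    Matrix.diagonal_transpose, Matrix.diagonal_mul_diagonal]
  simp only [Matrix.transpose_zero, Matrix.zero_mul, Matrix.mul_zero, add_zero, zero_add]
  congr
  ext i
  fin_cases i <;> simp [Real.mul_self_sqrt, h₁, h₂]

/-- Tridiagonality: one multiplication moves information by at most one vertex. -/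
lemma gram_pathMatrix_eq_zero {a b : Fin (d + 1)} (h : (b : ℕ) + 1 < a ∨ (a : ℕ) + 1 < b) :
    ((pathMatrix d).transpose * pathMatrix d) a b = 0 := by
  rw [Matrix.mul_apply]
  refine Finset.sum_eq_zero fun i _ => ?_
  simp only [Matrix.transpose_apply, pathMatrix, Matrix.of_apply]
  split_ifs with h1 h2 h3 h4 h5 h6 h7 h8 <;> simp_all [Fin.ext_iff] <;> omega

lemma spectrum_gram_constraintMatrix (hd : 1 ≤ d) {l₁ l₂ : ℝ} (h₁ : 0 < l₁) (h₁₂ : l₁ ≤ l₂)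
    (hb : PathBounds d l₁ l₂) {t : ℝ} (ht : t ∈ spectrum ℝ
      ((constraintMatrix d l₁ l₂).transpose * constraintMatrix d l₁ l₂)) (ht0 : t ≠ 0) :
    l₁ ≤ t ∧ t ≤ l₂ := by
  rw [← Matrix.spectrum_toLin'] at ht
  obtain ⟨w, hw, hw0⟩ := (Module.End.hasEigenvalue_iff_mem_spectrum.2 ht).exists_hasEigenvector
  rw [Module.End.mem_eigenspace_iff, Matrix.toLin'_apply,
    gram_constraintMatrix h₁.le (h₁.le.trans h₁₂), Matrix.fromBlocks_mulVec] at hw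
  set x : Fin (d + 1) → ℝ := w ∘ Sum.inl with hx
  set y : Fin 2 → ℝ := w ∘ Sum.inr with hy
  have hX : ((pathMatrix d).transpose * pathMatrix d).mulVec x = t • x := by
    ext i
    simpa [hx] using congrFun hw (Sum.inl i)
  have hY : ∀ i, ![l₁, l₂] i * y i = t * y i := by
    intro i
    have h := congrFun hw (Sum.inr i)
    rw [Sum.elim_inr, Matrix.zero_mulVec, zero_add, Matrix.mulVec_diagonal] at h
    exact h
  by_cases hy0 : y = 0
  · have hx0 : x ≠ 0 := by
      rintro h
      refine hw0 (funext fun i => ?_)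
      rcases i with i | i
      · exact congrFun h i
      · exact congrFun hy0 i
    have hpos : 0 < ∑ j, x j ^ 2 := by
      obtain ⟨j, hj⟩ := Function.ne_iff.1 hx0
      exact Finset.sum_pos' (fun i _ => sq_nonneg _) ⟨j, Finset.mem_univ _, by
        have : x j ≠ 0 := hj
        positivity⟩
    have hsq : ∑ i, (pathMatrix d).mulVec x i ^ 2 = t * ∑ j, x j ^ 2 := by
      have h := congrArg (fun z => dotProduct x z) hX
      rw [← Matrix.mulVec_mulVec, Matrix.dotProduct_mulVec, Matrix.vecMul_transpose] at h
      simpa [dotProduct, ← pow_two, Finset.mul_sum, mul_left_comm] using h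
    -- The weight vector spans the kernel direction; an eigenvector for `t ≠ 0` is orthogonal to it,
    -- so the Poincaré inequality applies.
    have horth : ∑ j, pathWeight d j * x j = 0 := by
      have h := congrArg (fun z => dotProduct (pathWeight d) z) hX
      rw [← Matrix.mulVec_mulVec, Matrix.dotProduct_mulVec, Matrix.vecMul_transpose,
        pathMatrix_mulVec_pathWeight hd, zero_dotProduct, dotProduct_smul] at h
      exact (mul_eq_zero.1 h.symm).resolve_left ht0
    obtain ⟨h3, h4⟩ := hb x
    have h5 := h4 horth
    rw [hsq] at h3 h5
    exact ⟨le_of_mul_le_mul_right h5 hpos, le_of_mul_le_mul_right h3 hpos⟩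
  · obtain ⟨i, hi⟩ := Function.ne_iff.1 hy0
    have h := mul_right_cancel₀ hi (hY i)
    fin_cases i
    · simp at h
      exact ⟨h.le, h ▸ h₁₂⟩
    · simp at h
      exact ⟨h ▸ h₁₂, h.ge⟩

end Path

/-! ### Orthogonal copies of the space that avoid the starting points -/

section Basis

/-- The standard orthonormal basis of `H`. -/
def stdBasis (k : ℕ) : H := lp.single 2 k (1 : ℝ)

lemma inner_stdBasis_left (k : ℕ) (x : H) : ⟪stdBasis k, x⟫_ℝ = x k := by
  rw [stdBasis, lp.inner_single_left]
  simp

lemma inner_stdBasis_right (k : ℕ) (x : H) : ⟪x, stdBasis k⟫_ℝ = x k := by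
  rw [real_inner_comm, inner_stdBasis_left]

lemma inner_stdBasis (k l : ℕ) : ⟪stdBasis k, stdBasis l⟫_ℝ = if k = l then 1 else 0 := by
  rw [inner_stdBasis_left, stdBasis, lp.single_apply]
  simp [Pi.single_apply]

lemma orthonormal_stdBasis : Orthonormal ℝ stdBasis :=
  orthonormal_iff_ite.2 inner_stdBasis

/-- The isometry that maps the standard basis to the orthonormal family `e`. -/
def isometryOf {E : Type*} [NormedAddCommGroup E] [InnerProductSpace ℝ E] [CompleteSpace E]
    {e : ℕ → E} (he : Orthonormal ℝ e) : H →ₗᵢ[ℝ] E :=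
  he.orthogonalFamily.linearIsometry

section

variable {E : Type*} [NormedAddCommGroup E] [InnerProductSpace ℝ E] [CompleteSpace E]
  {e : ℕ → E}

lemma isometryOf_stdBasis (he : Orthonormal ℝ e) (k : ℕ) : isometryOf he (stdBasis k) = e k := by
  rw [isometryOf, stdBasis, OrthogonalFamily.linearIsometry_apply_single]
  simp

lemma hasSum_isometryOf (he : Orthonormal ℝ e) (x : H) :
    HasSum (fun k => x k • e k) (isometryOf he x) :=
  he.orthogonalFamily.hasSum_linearIsometry x

lemma inner_isometryOf_eq_zero (he : Orthonormal ℝ e) {y : E} (h : ∀ k, ⟪e k, y⟫_ℝ = 0) (x : H) :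
    ⟪isometryOf he x, y⟫_ℝ = 0 := by
  have h1 := (hasSum_isometryOf he x).mapL (innerSL ℝ y)
  have h2 : (fun k => innerSL ℝ y (x k • e k)) = fun _ => 0 := by
    ext k
    rw [innerSL_apply_apply, real_inner_smul_right, real_inner_comm, h, mul_zero]
  rw [h2] at h1
  rw [real_inner_comm]
  exact h1.unique hasSum_zero

end

lemma not_finiteDimensional : ¬ FiniteDimensional ℝ H := fun _ =>
  (orthonormal_stdBasis.linearIndependent.finite).false

lemma exists_orthonormal_of_not_finiteDimensional {E : Type*} [NormedAddCommGroup E]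
    [InnerProductSpace ℝ E] [CompleteSpace E] (hE : ¬ FiniteDimensional ℝ E) (ι : Type*)
    [Countable ι] : ∃ e : ι → E, Orthonormal ℝ e := by
  obtain ⟨w, b, -⟩ := exists_hilbertBasis ℝ E
  have hw : Infinite w := by
    by_contra h
    have : Finite w := not_infinite_iff_finite.1 h
    refine hE (Module.finite_def.2 ?_)
    have hfg : (Submodule.span ℝ (Set.range b)).FG := Submodule.fg_span (Set.finite_range b)
    have : FiniteDimensional ℝ (Submodule.span ℝ (Set.range b)) := Module.Finite.iff_fg.2 hfg
    rw [← b.dense_span, IsClosed.submodule_topologicalClosure_eq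
      (Submodule.closed_of_finiteDimensional _)]
    exact hfg
  obtain ⟨g, hg⟩ := Countable.exists_injective_nat ι
  exact ⟨fun i => b (Infinite.natEmbedding w (g i)),
    b.orthonormal.comp _ ((Infinite.natEmbedding w).injective.comp hg)⟩

/-- The orthogonal complement of finitely many vectors is still infinite-dimensional. An orthonormal
family in it indexed by `ι × ℕ` splits into the required copies. This is how arbitrary starting
points are made uninformative. -/
lemma exists_isometricFamily {ι : Type*} [Countable ι] [DecidableEq ι] {n : ℕ} (x : Fin n → H) :
    ∃ V : ι → H →L[ℝ] H, IsometricFamily V ∧ ∀ i j, star (V i) (x j) = 0 := by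
  set W := Submodule.span ℝ (Set.range x) with hW
  have : FiniteDimensional ℝ W := FiniteDimensional.span_of_finite ℝ (Set.finite_range x)
  have hWo : ¬ FiniteDimensional ℝ Wᗮ := by
    intro h
    refine not_finiteDimensional ?_
    have h2 := Submodule.finiteDimensional_sup W Wᗮ
    rw [Submodule.sup_orthogonal_of_hasOrthogonalProjection] at h2
    exact Module.Finite.equiv (Submodule.topEquiv (R := ℝ) (M := H))
  obtain ⟨e, he⟩ := exists_orthonormal_of_not_finiteDimensional hWo (ι × ℕ)
  have he' : Orthonormal ℝ (fun a => (e a : H)) := he.comp_linearIsometry Wᗮ.subtypeₗᵢ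
  have hi : ∀ i, Orthonormal ℝ (fun k => (e (i, k) : H)) := fun i =>
    he'.comp (fun k => (i, k)) (Prod.mk_right_injective i)
  refine ⟨fun i => (isometryOf (hi i)).toContinuousLinearMap, fun i j => ?_, fun i j => ?_⟩
  · refine ContinuousLinearMap.ext fun x => ext_inner_right ℝ fun y => ?_
    rw [ContinuousLinearMap.star_eq_adjoint, mul_apply_eq_comp,
      ContinuousLinearMap.adjoint_inner_left]
    simp only [LinearIsometry.coe_toContinuousLinearMap]
    split_ifs with hij
    · subst hij
      rw [LinearIsometry.inner_map_map]
      rfl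
    · rw [zero_apply, inner_zero_left]
      refine inner_isometryOf_eq_zero _ (fun k => ?_) x
      rw [real_inner_comm]
      refine inner_isometryOf_eq_zero _ (fun l => ?_) y
      exact he'.2 (by simp [hij])
  · refine ext_inner_right ℝ fun y => ?_
    rw [ContinuousLinearMap.star_eq_adjoint, ContinuousLinearMap.adjoint_inner_left,
      inner_zero_left, real_inner_comm]
    refine inner_isometryOf_eq_zero (hi i) (fun k => ?_) y
    exact (Submodule.mem_orthogonal' W _).1 (e (i, k)).2 _
      (Submodule.subset_span (Set.mem_range_self j))

end Basis

/-! ### Projections that couple pairs of coordinates -/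

section Pairing

/-- The unitary operator that permutes the coordinates. -/
def permOp (σ : Equiv.Perm ℕ) : H →L[ℝ] H :=
  (isometryOf (orthonormal_stdBasis.comp σ σ.injective)).toContinuousLinearMap

/-- For an involution `σ`, the projection onto the vectors that are odd under `σ`. -/
def oddProj (σ : Equiv.Perm ℕ) : H →L[ℝ] H := (2⁻¹ : ℝ) • (1 - permOp σ)

variable {σ : Equiv.Perm ℕ}

lemma permOp_apply (hσ : ∀ k, σ (σ k) = k) (x : H) (k : ℕ) : permOp σ x k = x (σ k) := by
  have h : permOp σ (stdBasis (σ k)) = stdBasis k := by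
    rw [permOp, LinearIsometry.coe_toContinuousLinearMap, isometryOf_stdBasis,
      Function.comp_apply, hσ]
  rw [← inner_stdBasis_left, ← h, permOp, LinearIsometry.coe_toContinuousLinearMap,
    LinearIsometry.inner_map_map, inner_stdBasis_left]

lemma oddProj_apply (hσ : ∀ k, σ (σ k) = k) (x : H) (k : ℕ) :
    oddProj σ x k = (x k - x (σ k)) / 2 := by
  rw [← permOp_apply hσ, div_eq_inv_mul]
  rfl

lemma oddProj_symm (hσ : ∀ k, σ (σ k) = k) (x y : H) :
    ⟪oddProj σ x, y⟫_ℝ = ⟪x, oddProj σ y⟫_ℝ := by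
  have h : ⟪permOp σ x, y⟫_ℝ = ⟪x, permOp σ y⟫_ℝ := by
    have h1 : permOp σ (permOp σ x) = x := lp.ext (funext fun k => by
      rw [permOp_apply hσ, permOp_apply hσ, hσ])
    have h2 : ⟪permOp σ (permOp σ x), permOp σ y⟫_ℝ = ⟪permOp σ x, y⟫_ℝ :=
      LinearIsometry.inner_map_map _ _ _
    rw [← h2, h1]
  simp only [oddProj, smul_apply, sub_apply,
    one_apply_eq_self, real_inner_smul_left, real_inner_smul_right, inner_sub_left,
    inner_sub_right, h]

lemma oddProj_idem (hσ : ∀ k, σ (σ k) = k) (x : H) : oddProj σ (oddProj σ x) = oddProj σ x :=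
  lp.ext (funext fun k => by
    simp only [oddProj_apply hσ, hσ]
    ring)

variable {ι : Type*} [DecidableEq ι] {V : ι → H →L[ℝ] H}

lemma IsometricFamily.inner_apply (hV : IsometricFamily V) (i j : ι) (x y : H) :
    ⟪V i x, V j y⟫_ℝ = if i = j then ⟪x, y⟫_ℝ else 0 := by
  rw [← ContinuousLinearMap.adjoint_inner_right, ← ContinuousLinearMap.star_eq_adjoint,
    ← mul_apply_eq_comp, hV i j]
  split_ifs <;> simp

lemma IsometricFamily.star_apply (hV : IsometricFamily V) (i j : ι) (x : H) :
    star (V i) (V j x) = if i = j then x else 0 := by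
  rw [← mul_apply_eq_comp, hV i j]
  split_ifs <;> simp

/-- The operator `T` in the range of the isometry `J`. -/
def conjOp (J T : H →L[ℝ] H) : H →L[ℝ] H := J * T * star J

lemma conjOp_symm {J T : H →L[ℝ] H} (hT : ∀ x y, ⟪T x, y⟫_ℝ = ⟪x, T y⟫_ℝ) (x y : H) :
    ⟪conjOp J T x, y⟫_ℝ = ⟪x, conjOp J T y⟫_ℝ := by
  simp only [conjOp, mul_apply_eq_comp, ContinuousLinearMap.star_eq_adjoint]
  rw [← ContinuousLinearMap.adjoint_inner_right, hT, ContinuousLinearMap.adjoint_inner_left]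

lemma conjOp_apply (hV : IsometricFamily V) (T : H →L[ℝ] H) (i j : ι) (x : H) :
    conjOp (V i) T (V j x) = if i = j then V i (T x) else 0 := by
  rw [conjOp, mul_apply_eq_comp, hV.star_apply, mul_apply_eq_comp]
  split_ifs <;> simp

lemma conjOp_idem (hV : IsometricFamily V) {T : H →L[ℝ] H} (hT : ∀ x, T (T x) = T x) (i : ι)
    (x : H) : conjOp (V i) T (conjOp (V i) T x) = conjOp (V i) T x := by
  rw [show conjOp (V i) T x = V i (T (star (V i) x)) from rfl, conjOp_apply hV, if_pos rfl, hT]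

end Pairing

/-! ### Propagation of supports under the three kinds of steps -/

section Supported

variable {κ : Type*}

/-- The vectors whose coordinates in the families `V j` vanish outside of `S`. -/
def supported (V : κ → H →L[ℝ] H) (S : Set (ℕ × κ)) : Submodule ℝ H where
  carrier := {x | ∀ k j, (k, j) ∉ S → ⟪x, V j (stdBasis k)⟫_ℝ = 0}
  add_mem' hx hy k j h := by rw [inner_add_left, hx k j h, hy k j h, add_zero]
  zero_mem' k j _ := inner_zero_left _
  smul_mem' c x hx k j h := by rw [real_inner_smul_left, hx k j h, mul_zero]

variable {V : κ → H →L[ℝ] H} {S S' : Set (ℕ × κ)}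

lemma supported_mono (h : S ⊆ S') : supported V S ≤ supported V S' :=
  fun _ hx k j hkj => hx k j fun h' => hkj (h h')

variable {n : ℕ} {P : Problem n} {M : Fin n → Submodule ℝ H} {i : Fin n}

lemma localStep_le_supported {μ L : ℝ} {T : H →L[ℝ] H} {q : H}
    (hs : ∀ x y, ⟪T x, y⟫_ℝ = ⟪x, T y⟫_ℝ) (hi : ∀ x, T (T x) = T x) (hμ : 0 < μ) (hμL : μ ≤ L)
    (hf : P.f i = quadratic (hessian μ L T) q) (hM : M i ≤ supported V S) (hSS : S ⊆ S')
    (hq : q ∈ supported V S) (hT : ∀ x ∈ supported V S, T x ∈ supported V S') :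
    localStep P M i ≤ supported V S' := by
  have hH : ∀ (a b : ℝ), ∀ x ∈ supported V S, hessian a b T x ∈ supported V S' := fun a b x hx =>
    add_mem (Submodule.smul_mem _ _ (supported_mono hSS hx)) (Submodule.smul_mem _ _ (hT x hx))
  refine Submodule.span_le.2 (Set.union_subset (Set.union_subset ?_ ?_) ?_)
  · exact fun x hx => supported_mono hSS (hM hx)
  · rintro _ ⟨x, hx, rfl⟩
    rw [hf, gradient_quadratic (hessian_symm hs)]
    exact sub_mem (hH _ _ _ (hM hx)) (supported_mono hSS hq)
  · rintro _ ⟨x, hx, rfl⟩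
    have hpos : ∀ x, 0 ≤ ⟪hessian μ L T x, x⟫_ℝ := fun x =>
      (by positivity : 0 ≤ μ * ‖x‖ ^ 2).trans (le_hessian_inner hs hi hμL x)
    rw [hf, gradient_conjugate_quadratic (hessian_symm hs) (hessian_symm hs) hpos
      (hessian_hessian_inv hi hμ.ne' (hμ.trans_le hμL).ne')]
    exact hH _ _ _ (add_mem (hM hx) hq)

lemma commStep_le {G : SimpleGraph (Fin n)} {K : Submodule ℝ H} (hi : M i ≤ K)
    (h : ∀ j, G.Adj i j → M j ≤ K) : commStep G M i ≤ K :=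
  Submodule.span_le.2 (Set.union_subset hi (Set.iUnion₂_subset h))

lemma multStep_le_supported (hb : P.b i = 0) (hM : M i ≤ supported V S) (hSS : S ⊆ S')
    (hA : ∀ x ∈ supported V S,
      ContinuousLinearMap.adjoint (P.A i) (P.A i x) ∈ supported V S') :
    multStep P M i ≤ supported V S' := by
  refine Submodule.span_le.2 (Set.union_subset (Set.union_subset ?_ ?_) ?_)
  · exact fun x hx => supported_mono hSS (hM hx)
  · rw [hb, map_zero]
    rintro x (rfl | rfl) <;> exact zero_mem _
  · rintro _ ⟨x, hx, rfl⟩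
    exact hA x (hM hx)

lemma conjOp_oddProj_mem_supported [DecidableEq κ] (hV : IsometricFamily V) {σ : Equiv.Perm ℕ}
    (hσ : ∀ k, σ (σ k) = k) (j : κ) (hSS : S ⊆ S') (hS : ∀ k, (σ k, j) ∈ S → (k, j) ∈ S') {x : H}
    (hx : x ∈ supported V S) : conjOp (V j) (oddProj σ) x ∈ supported V S' := by
  intro k l hkl
  rw [conjOp_symm (oddProj_symm hσ), conjOp_apply hV]
  split_ifs with h
  · subst h
    have h1 : oddProj σ (stdBasis k) = (2⁻¹ : ℝ) • (stdBasis k - stdBasis (σ k)) := by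
      refine lp.ext (funext fun l => ?_)
      rw [oddProj_apply hσ, lp.coeFn_smul, lp.coeFn_sub, Pi.smul_apply, Pi.sub_apply]
      simp only [← inner_stdBasis_left, inner_stdBasis, smul_eq_mul]
      have : σ l = k ↔ l = σ k := ⟨fun h => by rw [← h, hσ], fun h => by rw [h, hσ]⟩
      simp only [this]
      ring
    rw [h1, map_smul, map_sub, real_inner_smul_right, inner_sub_right,
      hx _ _ (fun h => hkl (hSS h)), hx _ _ (fun h => hkl (hS _ h)), sub_zero, mul_zero]
  · exact inner_zero_right _

end Supported

/-! ### The hard problem and the coordinates reachable in it -/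

section HardProblem

/-- The involution that exchanges `2 k` and `2 k + 1`. -/
def evenSwap : Equiv.Perm ℕ :=
  Function.Involutive.toPerm (fun k => if k % 2 = 0 then k + 1 else k - 1) fun k => by
    dsimp only
    split_ifs <;> omega

/-- The involution that exchanges `2 k + 1` and `2 k + 2`. -/
def oddSwap : Equiv.Perm ℕ :=
  Function.Involutive.toPerm
    (fun k => if k = 0 then 0 else if k % 2 = 0 then k - 1 else k + 1) fun k => by
    grind

lemma evenSwap_apply (k : ℕ) : evenSwap k = if k % 2 = 0 then k + 1 else k - 1 := rfl

lemma oddSwap_apply (k : ℕ) :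
    oddSwap k = if k = 0 then 0 else if k % 2 = 0 then k - 1 else k + 1 := rfl

lemma evenSwap_evenSwap (k : ℕ) : evenSwap (evenSwap k) = k :=
  (Equiv.eq_symm_apply _).1 rfl

lemma oddSwap_oddSwap (k : ℕ) : oddSwap (oddSwap k) = k :=
  (Equiv.eq_symm_apply _).1 rfl

variable {d : ℕ} (V : Fin (d + 1) ⊕ Fin 2 → H →L[ℝ] H)

/-- The projection that couples the coordinates of agent `i`: the first `s` agents couple
coordinates at the start of the path, the next `s` agents at its end, and the others none. -/
def couplingProj (s i : ℕ) : H →L[ℝ] H :=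
  if i < s then conjOp (V (Sum.inl 0)) (oddProj oddSwap)
  else if i < 2 * s then conjOp (V (Sum.inl (Fin.last d))) (oddProj evenSwap) else 0

/-- The problem that is hard for every algorithm whose agents start orthogonally to the ranges
of `V`. -/
def hardProblem (n s : ℕ) (μ L β l₁ l₂ : ℝ) : Problem n where
  f i := quadratic (hessian μ L (couplingProj V s i))
    (if (i : ℕ) < s then β • V (Sum.inl 0) (stdBasis 0) else 0)
  A _ := matrixOp (fun r : Fin d ⊕ Fin 2 => V (Sum.map Fin.castSucc id r)) V
    (constraintMatrix d l₁ l₂)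
  b _ := 0

variable {V}

lemma couplingProj_symm (s i : ℕ) (x y : H) :
    ⟪couplingProj V s i x, y⟫_ℝ = ⟪x, couplingProj V s i y⟫_ℝ := by
  unfold couplingProj
  split_ifs
  · exact conjOp_symm (oddProj_symm oddSwap_oddSwap) x y
  · exact conjOp_symm (oddProj_symm evenSwap_evenSwap) x y
  · simp

lemma couplingProj_idem (hV : IsometricFamily V) (s i : ℕ) (x : H) :
    couplingProj V s i (couplingProj V s i x) = couplingProj V s i x := by
  unfold couplingProj
  split_ifs
  · exact conjOp_idem hV (oddProj_idem oddSwap_oddSwap) _ x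
  · exact conjOp_idem hV (oddProj_idem evenSwap_evenSwap) _ x
  · simp

lemma adjoint_hardProblem_A (hV : IsometricFamily V) {n s : ℕ} {μ L β l₁ l₂ : ℝ} (i : Fin n)
    (x : H) : ContinuousLinearMap.adjoint ((hardProblem V n s μ L β l₁ l₂).A i)
      ((hardProblem V n s μ L β l₁ l₂).A i x) =
        matrixOp V V ((constraintMatrix d l₁ l₂).transpose * constraintMatrix d l₁ l₂) x := by
  have hU : IsometricFamily fun r : Fin d ⊕ Fin 2 => V (Sum.map Fin.castSucc id r) := by
    intro i j
    rw [hV]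
    exact if_congr ((Sum.map_injective.2
      ⟨Fin.castSucc_injective d, Function.injective_id⟩).eq_iff) rfl rfl
  rw [← matrixOp_mul hU, ← star_matrixOp, mul_apply_eq_comp, ContinuousLinearMap.star_eq_adjoint]
  rfl

/-- The number of multiplications needed to reach vertex `j` of the path in coordinate `k`. -/
def multCost (d k j : ℕ) : ℕ := k * d + if k % 2 = 0 then j else d - j

/-- The number of communications needed by agent `i` to reach coordinate `k`. -/
def commCost (s p k i : ℕ) : ℕ :=
  k * p + if i < s then (if k % 2 = 0 then 0 else p)
    else if i < 2 * s then (if k % 2 = 0 then p else 0) else i - 2 * s + 1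

/-- The coordinates that agent `i` can have reached after `a` local computations, `m`
multiplications and `c` communications. -/
def reachable (d s p a m c i : ℕ) : Set (ℕ × Fin (d + 1)) :=
  {u | u.1 ≤ a ∧ multCost d u.1 u.2 ≤ m ∧ commCost s p u.1 i ≤ c}

lemma reachable_mono {s p a m c a' m' c' i : ℕ} (ha : a ≤ a') (hm : m ≤ m') (hc : c ≤ c') :
    reachable d s p a m c i ⊆ reachable d s p a' m' c' i :=
  fun _ h => ⟨h.1.trans ha, h.2.1.trans hm, h.2.2.trans hc⟩

/-- Coordinates `2k+1` and `2k+2` have equal multiplication cost at vertex `0` and equal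
communication cost in the first group, so exchanging them there costs only a local computation.
Coordinate `0` is fixed and free. -/
lemma reachable_oddSwap {s p a m c i k : ℕ} (hi : i < s)
    (h : (oddSwap k, (0 : Fin (d + 1))) ∈ reachable d s p a m c i) :
    (k, (0 : Fin (d + 1))) ∈ reachable d s p (a + 1) m c i := by
  simp only [reachable, Set.mem_ofPred_eq, multCost, commCost, hi, if_true, Fin.val_zero,
    oddSwap_apply] at h ⊢
  rcases Nat.even_or_odd' k with ⟨k, rfl | rfl⟩
  · rcases k with _ | k
    · simp
    · rw [if_neg (by omega), if_pos (by omega)] at h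
      simp only [show 2 * (k + 1) - 1 = 2 * k + 1 by omega, show (2 * k + 1) % 2 = 1 by omega,
        show 2 * (k + 1) % 2 = 0 by omega] at h ⊢
      simp only [one_ne_zero, if_false, if_true] at h ⊢
      have e : ∀ b, 2 * (k + 1) * b = (2 * k + 1) * b + b := fun b => by ring
      rw [e, e]
      omega
  · rw [if_neg (by omega), if_neg (by omega)] at h
    simp only [show (2 * k + 1 + 1) % 2 = 0 by omega, show (2 * k + 1) % 2 = 1 by omega] at h ⊢
    simp only [one_ne_zero, if_false, if_true] at h ⊢
    have e : ∀ b, (2 * k + 1 + 1) * b = (2 * k + 1) * b + b := fun b => by ring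
    rw [e, e] at h
    omega

/-- The mirror image for the pair `2k, 2k+1` at vertex `d` in the second group. -/
lemma reachable_evenSwap {s p a m c i k : ℕ} (hi : ¬ i < s) (hi' : i < 2 * s)
    (h : (evenSwap k, Fin.last d) ∈ reachable d s p a m c i) :
    (k, Fin.last d) ∈ reachable d s p (a + 1) m c i := by
  simp only [reachable, Set.mem_ofPred_eq, multCost, commCost, hi, hi', if_false, if_true,
    Fin.val_last, evenSwap_apply] at h ⊢
  rcases Nat.even_or_odd' k with ⟨k, rfl | rfl⟩
  · rw [if_pos (by omega)] at h
    simp only [show (2 * k + 1) % 2 = 1 by omega, show (2 * k) % 2 = 0 by omega] at h ⊢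
    simp only [one_ne_zero, if_false, if_true] at h ⊢
    have e : ∀ b, (2 * k + 1) * b = 2 * k * b + b := fun b => by ring
    rw [e, e] at h
    omega
  · rw [if_neg (by omega)] at h
    simp only [show 2 * k + 1 - 1 = 2 * k by omega, show (2 * k + 1) % 2 = 1 by omega,
      show (2 * k) % 2 = 0 by omega] at h ⊢
    simp only [one_ne_zero, if_false, if_true] at h ⊢
    have e : ∀ b, (2 * k + 1) * b = 2 * k * b + b := fun b => by ring
    rw [e, e]
    omega

lemma reachable_mult {s p a m c i k : ℕ} {j j' : Fin (d + 1)}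
    (hj : (j : ℕ) ≤ j' + 1 ∧ (j' : ℕ) ≤ j + 1)
    (h : (k, j') ∈ reachable d s p a m c i) : (k, j) ∈ reachable d s p a (m + 1) c i := by
  refine ⟨h.1, ?_, h.2.2⟩
  have h1 := h.2.1
  simp only [multCost] at h1 ⊢
  split_ifs at h1 ⊢ <;> omega

lemma commCost_lower (s p k i : ℕ) : k * p ≤ commCost s p k i := Nat.le_add_right _ _

lemma commCost_upper {s p k i : ℕ} (hi : i < 2 * s + p) : commCost s p k i ≤ (k + 1) * p := by
  rw [commCost, add_mul, one_mul]
  split_ifs <;> omega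

/-- The center of round `c` has index `c % p` among the relays. Since `k * p ≤ c`, the remainder is
at most `c - k * p`, so that receiving in this round is not earlier than its cost allows. -/
lemma commCost_center_le {s p k c i : ℕ} (h : commCost s p k i ≤ c) :
    commCost s p k (2 * s + c % p) ≤ c + 1 := by
  have h1 : k * p ≤ c := (commCost_lower s p k i).trans h
  have h2 : k * p + c % p ≤ c := by
    obtain ⟨u, rfl⟩ := Nat.exists_eq_add_of_le h1
    rw [Nat.mul_add_mod_self_right]
    exact Nat.add_le_add_left (Nat.mod_le _ _) _
  rw [commCost, if_neg (by omega), if_neg (by omega)]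
  omega

/-- A center that already knows coordinate `k` when it broadcasts must have received it in an
earlier round. This forces `c ≥ (k + 1) * p`, by which time every agent may know the coordinate. -/
lemma commCost_leaf_le {s p k c i : ℕ} (hi : i < 2 * s + p)
    (h : commCost s p k (2 * s + c % p) ≤ c) : commCost s p k i ≤ c + 1 := by
  refine (commCost_upper hi).trans ?_
  rw [commCost, if_neg (by omega), if_neg (by omega)] at h
  have h1 : k < c / p := by
    by_contra! h2
    have h3 := Nat.mul_le_mul_right p h2
    have h4 := Nat.div_add_mod' c p
    omega
  have h2 := (Nat.mul_le_mul_right p h1).trans (Nat.div_mul_le_self c p)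
  exact h2.trans (Nat.le_succ c)

lemma numSteps_succ (act : ℕ → Action) (t : Action) (k : ℕ) :
    numSteps act t (k + 1) = numSteps act t k + if act k = t then 1 else 0 := by
  rw [numSteps, Nat.count_succ, numSteps]

/-- Induction on the steps. The three counters are tracked simultaneously, so one invariant yields
all three lower bounds. -/
theorem memory_hardProblem_le (hV : IsometricFamily V) {n s p : ℕ} (hn : n = 2 * s + p)
    {μ L β l₁ l₂ : ℝ} (hμ : 0 < μ) (hμL : μ ≤ L) (hl₁ : 0 ≤ l₁) (hl₂ : 0 ≤ l₂)
    {center : ℕ → Fin n} (hc : ∀ r, (center r : ℕ) = 2 * s + r % p) {x0 : Fin n → H}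
    (hx0 : ∀ j i, star (V j) (x0 i) = 0) (act : ℕ → Action) (k : ℕ) (i : Fin n) :
    memory (hardProblem V n s μ L β l₁ l₂) (fun r => SimpleGraph.starGraph (center r)) x0 act k i ≤
      supported (fun j => V (Sum.inl j)) (reachable d s p (numSteps act .localComputation k)
        (numSteps act .multiplication k) (numSteps act .communication k) i) := by
  have hV' : IsometricFamily fun j : Fin (d + 1) => V (Sum.inl j) := by
    intro i j
    rw [hV]
    exact if_congr Sum.inl_injective.eq_iff rfl rfl
  induction k generalizing i with
  | zero =>
    refine (Submodule.span_singleton_le_iff_mem _ _).2 fun k j _ => ?_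
    rw [← ContinuousLinearMap.adjoint_inner_left, ← ContinuousLinearMap.star_eq_adjoint, hx0,
      inner_zero_left]
  | succ k ih =>
    rw [memory]
    simp only [numSteps_succ]
    cases hact : act k with
    | localComputation =>
      simp only [reduceCtorEq, if_true, if_false, add_zero]
      refine localStep_le_supported (couplingProj_symm s i) (couplingProj_idem hV s i) hμ hμL rfl
        (ih i) (reachable_mono (Nat.le_succ _) le_rfl le_rfl) ?_ fun x hx => ?_
      · split_ifs with hi
        · refine Submodule.smul_mem _ _ fun k j hkj => ?_
          rw [hV'.inner_apply 0 j, inner_stdBasis]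
          split_ifs with h1 h2
          · subst h1 h2
            exact absurd (by simp [reachable, multCost, commCost, hi]) hkj
          · rfl
          · rfl
        · exact zero_mem _
      · unfold couplingProj
        split_ifs with h1 h2
        · exact conjOp_oddProj_mem_supported hV' oddSwap_oddSwap 0
            (reachable_mono (Nat.le_succ _) le_rfl le_rfl) (fun k => reachable_oddSwap h1) hx
        · exact conjOp_oddProj_mem_supported hV' evenSwap_evenSwap (Fin.last d)
            (reachable_mono (Nat.le_succ _) le_rfl le_rfl) (fun k => reachable_evenSwap h1 h2) hx
        · exact zero_mem _
    | communication =>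
      simp only [reduceCtorEq, if_true, if_false, add_zero]
      refine commStep_le ((ih i).trans
        (supported_mono (reachable_mono le_rfl le_rfl (Nat.le_succ _)))) fun j hj => ?_
      refine (ih j).trans (supported_mono fun u hu => ⟨hu.1, hu.2.1, ?_⟩)
      rw [SimpleGraph.starGraph_adj] at hj
      rcases hj.2 with h | h
      · rw [h, hc]
        exact commCost_center_le hu.2.2
      · have := hu.2.2
        rw [h, hc] at this
        exact commCost_leaf_le (hn ▸ i.2) this
    | multiplication =>
      simp only [reduceCtorEq, if_true, if_false, add_zero]
      refine multStep_le_supported rfl (ih i) (reachable_mono le_rfl (Nat.le_succ _) le_rfl)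
        fun x hx k j hkj => ?_
      set M := (constraintMatrix d l₁ l₂).transpose * constraintMatrix d l₁ l₂ with hM
      have hMT : M.transpose = M := by rw [hM, Matrix.transpose_mul, Matrix.transpose_transpose]
      -- The Gram operator is self-adjoint and is moved onto the basis vector, which it sends to
      -- neighbouring vertices with the same coordinate `k`.
      rw [adjoint_hardProblem_A hV, ← hM, ← hMT, ← star_matrixOp,
        ContinuousLinearMap.star_eq_adjoint, ContinuousLinearMap.adjoint_inner_left,
        ← mul_apply_eq_comp, matrixOp_mul_apply hV, sum_apply, inner_sum]
      refine Finset.sum_eq_zero fun j' _ => ?_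
      rw [smul_apply, real_inner_smul_right, hM, gram_constraintMatrix hl₁ hl₂]
      rcases j' with j' | j'
      · rw [Matrix.fromBlocks_apply₁₁]
        by_cases hjj : (j : ℕ) ≤ j' + 1 ∧ (j' : ℕ) ≤ j + 1
        · rw [hx k j' fun h => hkj (reachable_mult hjj h), mul_zero]
        · rw [gram_pathMatrix_eq_zero (by omega), zero_mul]
      · rw [Matrix.fromBlocks_apply₂₁, Matrix.zero_apply, zero_mul]

end HardProblem

/-! ### Spectrum of the block Gram operator -/

section GramSpectrum

variable {n : ℕ} {P : Problem n}

lemma gramA_apply (x : PiLp 2 fun _ : Fin n => H) (i : Fin n) :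
    P.gramA x i = ContinuousLinearMap.adjoint (P.A i) (P.A i (x i)) := by
  have h : P.gramA x = WithLp.toLp 2 fun i =>
      ContinuousLinearMap.adjoint (P.A i) (P.A i (x i)) := by
    refine ext_inner_right ℝ fun y => ?_
    rw [show P.gramA x = ContinuousLinearMap.adjoint P.blockA (P.blockA x) from rfl,
      ContinuousLinearMap.adjoint_inner_left, PiLp.inner_apply, PiLp.inner_apply]
    refine Finset.sum_congr rfl fun i _ => ?_
    rw [ContinuousLinearMap.adjoint_inner_left]
    rfl
  rw [h]

/-- All agents share the same Gram operator, so its resolvent applied agentwise inverts the block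
operator. -/
lemma mem_spectrum_of_mem_spectrum_gramA {T : H →L[ℝ] H}
    (hT : ∀ i x, ContinuousLinearMap.adjoint (P.A i) (P.A i x) = T x) {t : ℝ}
    (ht : t ∈ spectrum ℝ P.gramA) : t ∈ spectrum ℝ T := by
  by_contra h
  refine ht ?_
  obtain ⟨R, hR₁, hR₂⟩ := isUnit_iff_exists.1 (spectrum.notMem_iff.1 h)
  have h1 : ∀ x, t • R x - T (R x) = x := fun x => by
    simpa [Algebra.algebraMap_eq_smul_one] using DFunLike.congr_fun hR₁ x
  have h2 : ∀ x, R (t • x - T x) = x := fun x => by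
    simpa [Algebra.algebraMap_eq_smul_one] using DFunLike.congr_fun hR₂ x
  let S : Module.End ℝ (PiLp 2 fun _ : Fin n => H) :=
    { toFun := fun x => WithLp.toLp 2 fun i => R (x i)
      map_add' := fun x y => by ext i; simp
      map_smul' := fun c x => by ext i; simp }
  refine isUnit_iff_exists.2 ⟨S, ?_, ?_⟩
  · refine LinearMap.ext fun x => PiLp.ext fun i => ?_
    have h3 : P.gramA (S x) i = T (R (x i)) := by
      rw [gramA_apply, hT]
      rfl
    rw [Module.End.mul_apply, LinearMap.sub_apply, PiLp.sub_apply, h3,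
      Module.algebraMap_end_apply, PiLp.smul_apply]
    exact h1 (x i)
  · refine LinearMap.ext fun x => PiLp.ext fun i => ?_
    rw [Module.End.mul_apply, LinearMap.sub_apply, Module.algebraMap_end_apply]
    change R ((t • x - P.gramA x) i) = x i
    rw [PiLp.sub_apply, gramA_apply, hT, PiLp.smul_apply, h2]

lemma hasEigenvalue_gramA (hn : 0 < n) {T : H →L[ℝ] H}
    (hT : ∀ i x, ContinuousLinearMap.adjoint (P.A i) (P.A i x) = T x) {t : ℝ} {x : H}
    (hx : x ≠ 0) (hTx : T x = t • x) : P.gramA.HasEigenvalue t := by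
  refine Module.End.hasEigenvalue_of_hasEigenvector (x := WithLp.toLp 2 fun _ => x) ⟨?_, ?_⟩
  · rw [Module.End.mem_eigenspace_iff]
    refine PiLp.ext fun i => ?_
    rw [gramA_apply, hT]
    exact hTx
  · intro h
    exact hx (congrArg (fun y : PiLp 2 (fun _ : Fin n => H) => y ⟨0, hn⟩) h)

variable {d : ℕ} {V : Fin (d + 1) ⊕ Fin 2 → H →L[ℝ] H}

lemma IsometricFamily.apply_ne_zero {ι : Type*} [DecidableEq ι] {V : ι → H →L[ℝ] H}
    (hV : IsometricFamily V) (i : ι) (k : ℕ) : V i (stdBasis k) ≠ 0 := by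
  intro h
  have := hV.inner_apply i i (stdBasis k) (stdBasis k)
  rw [h, inner_zero_left, if_pos rfl, inner_stdBasis, if_pos rfl] at this
  exact zero_ne_one this

lemma hardProblem_isLambda (hV : IsometricFamily V) (hd : 1 ≤ d) {n s : ℕ} (hn : 0 < n)
    {μ L β l₁ l₂ : ℝ} (h₁ : 0 < l₁) (h₁₂ : l₁ ≤ l₂) (hb : PathBounds d l₁ l₂) :
    IsLambdaMinPos (hardProblem V n s μ L β l₁ l₂).gramA l₁ ∧
      IsLambdaMax (hardProblem V n s μ L β l₁ l₂).gramA l₂ := by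
  have hT := adjoint_hardProblem_A hV (n := n) (s := s) (μ := μ) (L := L) (β := β) (l₁ := l₁)
    (l₂ := l₂)
  have hspec : ∀ t ∈ spectrum ℝ (hardProblem V n s μ L β l₁ l₂).gramA, t ≠ 0 →
      l₁ ≤ t ∧ t ≤ l₂ := by
    intro t ht ht0
    refine spectrum_gram_constraintMatrix hd h₁ h₁₂ hb ?_ ht0
    by_contra h
    exact notMem_spectrum_matrixOp hV ht0 h (mem_spectrum_of_mem_spectrum_gramA hT ht)
  have heig : ∀ a : Fin 2, (hardProblem V n s μ L β l₁ l₂).gramA.HasEigenvalue (![l₁, l₂] a) := by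
    intro a
    refine hasEigenvalue_gramA hn hT (hV.apply_ne_zero (Sum.inr a) 0) ?_
    rw [← mul_apply_eq_comp, matrixOp_mul_apply hV, gram_constraintMatrix h₁.le (h₁.le.trans h₁₂),
      Fintype.sum_sum_type]
    simp only [Matrix.fromBlocks_apply₁₂, Matrix.fromBlocks_apply₂₂, Matrix.zero_apply, zero_smul,
      Finset.sum_const_zero, zero_add, Matrix.diagonal_apply, ite_smul, Finset.sum_ite_eq',
      Finset.mem_univ, if_true]
    rfl
  refine ⟨⟨h₁, heig 0, fun t ht h0 => (hspec t ht h0.ne').1⟩, heig 1, fun t ht => ?_⟩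
  rcases eq_or_ne t 0 with rfl | h0
  · exact h₁.le.trans h₁₂
  · exact (hspec t ht h0).2

end GramSpectrum

/-! ### The geometric solution -/

section Solution

lemma memℓp_geometric {r : ℝ} (hr0 : 0 ≤ r) (hr1 : r < 1) :
    Memℓp (fun k : ℕ => r ^ k / r) 2 := by
  refine memℓp_gen ?_
  have h : Summable fun k : ℕ => (r ^ 2) ^ k / r ^ 2 :=
    (summable_geometric_of_lt_one (sq_nonneg r) (by nlinarith)).div_const _
  convert h using 2 with k
  rw [ENNReal.toReal_ofNat, Real.rpow_ofNat, Real.norm_eq_abs, sq_abs]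
  ring

/-- The sequence `k ↦ r ^ (k - 1)`. -/
def geometric (r : ℝ) (hr0 : 0 ≤ r) (hr1 : r < 1) : H :=
  ⟨fun k => r ^ k / r, memℓp_geometric hr0 hr1⟩

lemma geometric_apply {r : ℝ} (hr0 : 0 ≤ r) (hr1 : r < 1) (k : ℕ) :
    geometric r hr0 hr1 k = r ^ k / r := rfl

variable {d : ℕ} {V : Fin (d + 1) ⊕ Fin 2 → H →L[ℝ] H}

/-- The point with coordinates `w j • ρ` along the path, where `w` are the path weights. -/
def spread (V : Fin (d + 1) ⊕ Fin 2 → H →L[ℝ] H) (ρ : H) : H :=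
  ∑ j, pathWeight d j • V (Sum.inl j) ρ

lemma hardProblem_A_spread (hV : IsometricFamily V) (hd : 1 ≤ d) {n s : ℕ} {μ L β l₁ l₂ : ℝ}
    (i : Fin n) (ρ : H) : (hardProblem V n s μ L β l₁ l₂).A i (spread V ρ) = 0 := by
  change matrixOp (fun r : Fin d ⊕ Fin 2 => V (Sum.map Fin.castSucc id r)) V
    (constraintMatrix d l₁ l₂) (spread V ρ) = 0
  simp only [spread, map_sum, map_smul, ← mul_apply_eq_comp, matrixOp_mul_apply hV]
  simp only [sum_apply, smul_apply, Finset.smul_sum, smul_smul]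
  rw [Finset.sum_comm]
  refine Finset.sum_eq_zero fun r _ => ?_
  rw [← Finset.sum_smul]
  convert zero_smul ℝ _
  rcases r with r | r
  · have := congrFun (pathMatrix_mulVec_pathWeight hd) r
    simpa [constraintMatrix, Matrix.mulVec, dotProduct, mul_comm] using this
  · simp [constraintMatrix]

/-- Each row of the incidence matrix equates the rescaled components at two consecutive vertices;
induction along the path makes all of them equal. -/
lemma exists_of_hardProblem_A_eq_zero (hV : IsometricFamily V) (hd : 1 ≤ d) {n s : ℕ}
    {μ L β l₁ l₂ : ℝ} {i : Fin n} {z : H} (hz : (hardProblem V n s μ L β l₁ l₂).A i z = 0) :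
    ∃ η : H, ∀ j, star (V (Sum.inl j)) z = pathWeight d j • η := by
  have hw : ∀ j, pathWeight d j ≠ 0 := fun j =>
    (zero_lt_one.trans_le (one_le_pathWeight hd j)).ne'
  have h1 : ∀ r : Fin d, (pathWeight d r.castSucc)⁻¹ • star (V (Sum.inl r.castSucc)) z =
      (pathWeight d r.succ)⁻¹ • star (V (Sum.inl r.succ)) z := by
    intro r
    have h2 := congrArg (fun y => star (V (Sum.inl r.castSucc)) y) hz
    change star (V (Sum.inl r.castSucc)) (matrixOp
      (fun r : Fin d ⊕ Fin 2 => V (Sum.map Fin.castSucc id r)) V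
      (constraintMatrix d l₁ l₂) z) = _ at h2
    have h3 : ∀ r' : Fin d ⊕ Fin 2, (Sum.inl r.castSucc = Sum.map Fin.castSucc id r') ↔
        Sum.inl r = r' := by
      rintro (r' | r') <;> simp
    simp only [matrixOp, sum_apply, smul_apply, mul_apply_eq_comp, map_sum, map_smul,
      hV.star_apply, h3, map_zero] at h2
    rw [Finset.sum_eq_single (Sum.inl r) (fun r' _ hr' => by simp [hr'.symm]) (by simp),
      Fintype.sum_sum_type] at h2
    simp only [if_true, constraintMatrix, Matrix.fromBlocks_apply₁₁, Matrix.fromBlocks_apply₁₂,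
      Matrix.zero_apply, zero_smul, Finset.sum_const_zero, add_zero, pathMatrix, Matrix.of_apply,
      sub_smul, ite_smul, Finset.sum_sub_distrib, Finset.sum_ite_eq', Finset.mem_univ] at h2
    exact sub_eq_zero.1 h2
  refine ⟨(pathWeight d 0)⁻¹ • star (V (Sum.inl 0)) z, fun j => ?_⟩
  have h4 : (pathWeight d j)⁻¹ • star (V (Sum.inl j)) z =
      (pathWeight d 0)⁻¹ • star (V (Sum.inl 0)) z := by
    induction j using Fin.induction with
    | zero => rfl
    | succ j ih => rw [← h1, ih]
  rw [← h4, smul_smul, mul_inv_cancel₀ (hw j), one_smul]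

lemma inner_apply_of_star_eq {z η : H}
    (hη : ∀ j, star (V (Sum.inl j)) z = pathWeight d j • η) (j : Fin (d + 1)) (x : H) :
    ⟪V (Sum.inl j) x, z⟫_ℝ = pathWeight d j * ⟪x, η⟫_ℝ := by
  rw [← ContinuousLinearMap.adjoint_inner_right, ← ContinuousLinearMap.star_eq_adjoint, hη,
    real_inner_smul_right]

lemma inner_spread {z η : H} (hη : ∀ j, star (V (Sum.inl j)) z = pathWeight d j • η) (ρ : H) :
    ⟪spread V ρ, z⟫_ℝ = (∑ j, pathWeight d j ^ 2) * ⟪ρ, η⟫_ℝ := by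
  rw [spread, sum_inner, Finset.sum_mul]
  refine Finset.sum_congr rfl fun j _ => ?_
  rw [real_inner_smul_left, inner_apply_of_star_eq hη]
  ring

lemma conjOp_spread (hV : IsometricFamily V) (T : H →L[ℝ] H) (j : Fin (d + 1)) (ρ : H) :
    conjOp (V (Sum.inl j)) T (spread V ρ) = pathWeight d j • V (Sum.inl j) (T ρ) := by
  simp only [spread, map_sum, map_smul, conjOp_apply hV, Sum.inl_injective.eq_iff, smul_ite,
    smul_zero, Finset.sum_ite_eq, Finset.mem_univ, if_true]

lemma sum_agents (s p : ℕ) (a b : ℝ) :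
    ∑ i : Fin (2 * s + p), (if (i : ℕ) < s then a else if (i : ℕ) < 2 * s then b else 0) =
      s * a + s * b := by
  rw [Fin.sum_univ_eq_sum_range (fun i => if i < s then a else if i < 2 * s then b else 0),
    two_mul, Finset.sum_range_add, Finset.sum_range_add]
  have h1 : ∀ i ∈ Finset.range s, (if i < s then a else if i < 2 * s then b else 0) = a :=
    fun i hi => if_pos (Finset.mem_range.1 hi)
  have h2 : ∀ i ∈ Finset.range s,
      (if s + i < s then a else if s + i < 2 * s then b else 0) = b := fun i hi => by
    have := Finset.mem_range.1 hi
    rw [if_neg (by omega), if_pos (by omega)]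
  have h3 : ∀ i ∈ Finset.range p,
      (if s + s + i < s then a else if s + s + i < 2 * s then b else 0) = 0 := fun i _ => by
    rw [if_neg (by omega), if_neg (by omega)]
  simp only [← two_mul] at h3 ⊢
  rw [Finset.sum_congr rfl h1, Finset.sum_congr rfl h2, Finset.sum_congr rfl h3]
  simp

/-- The linear term of the hard problem for which its solution is geometric. -/
def linearCoeff (n s d : ℕ) (μ L r : ℝ) : ℝ :=
  (n * μ * (∑ j, pathWeight d j ^ 2) / r + (L - μ) * s * d / 2 * (1 / r - 1)) / (s * √d)

/-- Away from `0` the two swaps send a coordinate to its two neighbours, in an order that depends on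
parity, so the sum of the projections is half the discrete Laplacian. Geometric sequences solve the
recurrence precisely under `hr`, and `linearCoeff` is chosen to satisfy the boundary equation at
`0`. -/
lemma geometric_stationary {n s : ℕ} (hs : 0 < s) (hd : 1 ≤ d) {μ L r : ℝ} (hr0 : 0 < r)
    (hr1 : r < 1) (hr : (L - μ) * s * d * (1 - r) ^ 2 =
      2 * n * μ * (∑ j, pathWeight d j ^ 2) * r) :
    (n * μ * ∑ j, pathWeight d j ^ 2) • geometric r hr0.le hr1 +
        ((L - μ) * s * d) • (oddProj oddSwap (geometric r hr0.le hr1) +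
          oddProj evenSwap (geometric r hr0.le hr1)) -
      (s * linearCoeff n s d μ L r * √d) • stdBasis 0 = 0 := by
  have hs' : (0 : ℝ) < s := by exact_mod_cast hs
  have hd' : (0 : ℝ) < √d := Real.sqrt_pos.2 (by exact_mod_cast hd)
  set S := ∑ j, pathWeight d j ^ 2 with hS
  refine lp.ext (funext fun k => ?_)
  simp only [lp.coeFn_smul, lp.coeFn_sub, lp.coeFn_add, Pi.smul_apply, Pi.sub_apply, Pi.add_apply,
    oddProj_apply oddSwap_oddSwap, oddProj_apply evenSwap_evenSwap, smul_eq_mul,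
    ← inner_stdBasis_left k (stdBasis 0), inner_stdBasis, geometric_apply]
  rcases k with _ | k
  · have h1 : oddSwap 0 = 0 := rfl
    have h2 : evenSwap 0 = 1 := rfl
    have h3 : s * linearCoeff n s d μ L r * √d =
        n * μ * S / r + (L - μ) * s * d / 2 * (1 / r - 1) := by
      rw [linearCoeff, ← hS]
      field_simp
    rw [h1, h2, if_pos rfl, h3]
    change _ = (0 : ℝ)
    field_simp
    ring
  · have h1 : r ^ (oddSwap (k + 1)) / r + r ^ (evenSwap (k + 1)) / r =
        r ^ k / r + r ^ (k + 2) / r := by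
      rw [oddSwap_apply, evenSwap_apply, if_neg (by omega)]
      split_ifs
      · rfl
      · exact add_comm _ _
    rw [if_neg (by omega), mul_zero, sub_zero]
    change _ = (0 : ℝ)
    have h2 : n * μ * S * (r ^ (k + 1) / r) + (L - μ) * s * d *
        ((r ^ (k + 1) / r - r ^ (oddSwap (k + 1)) / r) / 2 +
          (r ^ (k + 1) / r - r ^ (evenSwap (k + 1)) / r) / 2) =
        n * μ * S * (r ^ (k + 1) / r) + (L - μ) * s * d *
          (r ^ (k + 1) / r - (r ^ k / r + r ^ (k + 2) / r) / 2) := by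
      rw [← h1]
      ring
    rw [h2]
    field_simp
    linear_combination (-r ^ k) * hr

/-- The summed gradient is orthogonal to the kernel of the constraint, by pairing
`geometric_stationary` with `η`; what remains of the exact quadratic expansion is nonnegative. -/
lemma hardProblem_isSolution (hV : IsometricFamily V) (hd : 1 ≤ d) {n s p : ℕ}
    (hn : n = 2 * s + p) (hs : 0 < s) {μ L r l₁ l₂ : ℝ} (hμ : 0 ≤ μ) (hμL : μ ≤ L) (hr0 : 0 < r)
    (hr1 : r < 1) (hr : (L - μ) * s * d * (1 - r) ^ 2 =
      2 * n * μ * (∑ j, pathWeight d j ^ 2) * r) :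
    (hardProblem V n s μ L (linearCoeff n s d μ L r) l₁ l₂).IsSolution
      fun _ => spread V (geometric r hr0.le hr1) := by
  set ρ := geometric r hr0.le hr1 with hρ
  set β := linearCoeff n s d μ L r with hβ
  set P := hardProblem V n s μ L β l₁ l₂ with hP
  refine ⟨⟨fun i => hardProblem_A_spread hV hd i ρ, fun _ _ => rfl⟩, fun y hy => ?_⟩
  set q : Fin n → H := fun i => if (i : ℕ) < s then β • V (Sum.inl 0) (stdBasis 0) else 0 with hq
  set Q : Fin n → H →L[ℝ] H := fun i => hessian μ L (couplingProj V s i) with hQ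
  have hQs : ∀ i x y, ⟪Q i x, y⟫_ℝ = ⟪x, Q i y⟫_ℝ := fun i => hessian_symm (couplingProj_symm s i)
  have horth : ∀ i z, P.A i z = 0 → ∑ j, ⟪Q j (spread V ρ) - q j, z⟫_ℝ = 0 := by
    intro i z hz
    obtain ⟨η, hη⟩ := exists_of_hardProblem_A_eq_zero hV hd hz
    have h1 : ∀ j : Fin n, ⟪Q j (spread V ρ) - q j, z⟫_ℝ =
        μ * ((∑ j, pathWeight d j ^ 2) * ⟪ρ, η⟫_ℝ) + if (j : ℕ) < s then
          (L - μ) * (d * ⟪oddProj oddSwap ρ, η⟫_ℝ) - β * (√d * ⟪stdBasis 0, η⟫_ℝ)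
        else if (j : ℕ) < 2 * s then (L - μ) * (d * ⟪oddProj evenSwap ρ, η⟫_ℝ) else 0 := by
      intro j
      have hdd : √(d : ℝ) * √d = d := Real.mul_self_sqrt (Nat.cast_nonneg d)
      rw [hQ, hq, inner_sub_left]
      simp only [hessian_apply, couplingProj]
      rw [inner_add_left, real_inner_smul_left, real_inner_smul_left, inner_spread hη]
      split_ifs with h2 h3
      · rw [conjOp_spread hV, real_inner_smul_left, real_inner_smul_left,
          inner_apply_of_star_eq hη, inner_apply_of_star_eq hη, pathWeight_zero]
        linear_combination ((L - μ) * ⟪oddProj oddSwap ρ, η⟫_ℝ) * hdd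
      · rw [conjOp_spread hV, real_inner_smul_left, inner_apply_of_star_eq hη, pathWeight_last,
          inner_zero_left]
        linear_combination ((L - μ) * ⟪oddProj evenSwap ρ, η⟫_ℝ) * hdd
      · simp
    have h2 := congrArg (fun v : H => ⟪v, η⟫_ℝ) (geometric_stationary hs hd hr0 hr1 hr)
    simp only [inner_sub_left, inner_add_left, real_inner_smul_left, inner_zero_left] at h2
    rw [← hρ, ← hβ] at h2
    simp only [h1, Finset.sum_add_distrib, Finset.sum_const, Finset.card_univ, Fintype.card_fin,
      nsmul_eq_mul]
    subst hn
    rw [sum_agents, ← h2]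
    ring
  have hi : ∃ i : Fin n, ∀ j, y j = y i := ⟨⟨0, by omega⟩, fun j => hy.2 _ _⟩
  obtain ⟨i, hi⟩ := hi
  have hyi : P.A i (y i) = 0 := hy.1 i
  have h1 : ∀ j, P.f j (y j) = P.f j (spread V ρ) +
      (⟪Q j (spread V ρ) - q j, y i⟫_ℝ - ⟪Q j (spread V ρ) - q j, spread V ρ⟫_ℝ) +
        ⟪Q j (y i - spread V ρ), y i - spread V ρ⟫_ℝ / 2 := by
    intro j
    rw [hi j, ← inner_sub_right]
    exact quadratic_expand (hQs j) (q j) (spread V ρ) (y i)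
  have h2 : 0 ≤ ∑ j, ⟪Q j (y i - spread V ρ), y i - spread V ρ⟫_ℝ / 2 := by
    refine Finset.sum_nonneg fun j _ => div_nonneg (le_trans ?_ (le_hessian_inner
      (couplingProj_symm s j) (couplingProj_idem hV s j) hμL _)) two_pos.le
    positivity
  simp only [h1, Finset.sum_add_distrib, Finset.sum_sub_distrib, horth i _ hyi,
    horth i _ (hardProblem_A_spread hV hd i ρ)]
  linarith

end Solution

/-! ### Error of a missing coordinate and the contraction rate -/

section Rate

lemma sq_le_norm_sub_spread_sq {d : ℕ} {V : Fin (d + 1) ⊕ Fin 2 → H →L[ℝ] H}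
    (hV : IsometricFamily V) (hd : 1 ≤ d) {S : Set (ℕ × Fin (d + 1))} {x : H}
    (hx : x ∈ supported (fun j => V (Sum.inl j)) S) {k : ℕ} (hk : (k, 0) ∉ S) (ρ : H) :
    ρ k ^ 2 ≤ ‖x - spread V ρ‖ ^ 2 := by
  have h1 : ⟪x - spread V ρ, V (Sum.inl 0) (stdBasis k)⟫_ℝ = -(√d * ρ k) := by
    rw [inner_sub_left, hx k 0 hk, zero_sub, neg_inj, spread, sum_inner]
    simp only [real_inner_smul_left, hV.inner_apply, Sum.inl_injective.eq_iff, mul_ite, mul_zero,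
      Finset.sum_ite_eq', Finset.mem_univ, if_true, pathWeight_zero, inner_stdBasis_right]
  have h2 : ‖V (Sum.inl 0) (stdBasis k)‖ = 1 := by
    have := hV.inner_apply (Sum.inl 0) (Sum.inl 0) (stdBasis k) (stdBasis k)
    rw [if_pos rfl, inner_stdBasis, if_pos rfl, real_inner_self_eq_norm_sq] at this
    exact (pow_eq_one_iff_of_nonneg (norm_nonneg _) two_ne_zero).1 this
  have h3 := abs_real_inner_le_norm (x - spread V ρ) (V (Sum.inl 0) (stdBasis k))
  rw [h1, h2, mul_one, abs_neg] at h3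
  have h4 : |ρ k| ≤ |√d * ρ k| := by
    rw [abs_mul, abs_of_nonneg (Real.sqrt_nonneg _)]
    exact le_mul_of_one_le_left (abs_nonneg _) (Real.one_le_sqrt.2 (by exact_mod_cast hd))
  rw [← sq_abs]
  exact pow_le_pow_left₀ (abs_nonneg _) (h4.trans h3) 2

/-- With `t = 2 a` the equation becomes `4 * sinh a ^ 2 = θ`, and `a ≤ sinh a` bounds `t`. -/
lemma exists_rate {θ : ℝ} (hθ : 0 < θ) :
    ∃ t : ℝ, 0 < t ∧ t ^ 2 ≤ θ ∧ (1 - Real.exp (-t)) ^ 2 = θ * Real.exp (-t) := by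
  have hpos : 0 < Real.arsinh (√θ / 2) := Real.arsinh_pos_iff.2 (by positivity)
  refine ⟨2 * Real.arsinh (√θ / 2), by positivity, ?_, ?_⟩
  · have h1 := Real.self_le_sinh_iff.2 hpos.le
    rw [Real.sinh_arsinh] at h1
    have h2 : 2 * Real.arsinh (√θ / 2) ≤ √θ := by linarith
    calc _ ≤ √θ ^ 2 := pow_le_pow_left₀ (by positivity) h2 2
      _ = θ := Real.sq_sqrt hθ.le
  · set a := Real.arsinh (√θ / 2) with ha
    have h1 : Real.sinh a = √θ / 2 := Real.sinh_arsinh _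
    rw [Real.sinh_eq] at h1
    have h2 : (Real.exp a - Real.exp (-a)) ^ 2 = θ := by
      rw [← Real.sq_sqrt hθ.le]
      congr 1
      linarith
    have h3 : Real.exp (-(2 * a)) = Real.exp (-a) ^ 2 := by
      rw [← Real.exp_nat_mul]
      congr 1
      push_cast
      ring
    have h4 : Real.exp a * Real.exp (-a) = 1 := by rw [← Real.exp_add, add_neg_cancel, Real.exp_zero]
    rw [h3, ← h2]
    linear_combination (-(Real.exp a * Real.exp (-a)) - 1 + 2 * Real.exp (-a) ^ 2) * h4

lemma log_inv_le_of_geometric_sq_le {t ε : ℝ} (h0 : 0 ≤ Real.exp (-t)) (h1 : Real.exp (-t) < 1)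
    {m : ℕ} (h : geometric (Real.exp (-t)) h0 h1 (m + 1) ^ 2 ≤ ε) :
    Real.log (1 / ε) ≤ 2 * t * m := by
  -- The normalization `r ^ k / r` absorbs the shift from `m` to `m + 1`, so no additive loss
  -- appears.
  rw [geometric_apply, pow_succ (Real.exp (-t)), mul_div_cancel_right₀ _ (Real.exp_pos _).ne', ← Real.exp_nat_mul,
    ← Real.exp_nat_mul] at h
  have h2 := Real.log_le_log (Real.exp_pos _) h
  rw [Real.log_exp] at h2
  rw [one_div, Real.log_inv]
  push_cast at h2
  linarith

end Rate

/-! ### Constants -/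

section Bounds

/-- The coupling strength of the hard problem yields a contraction rate `exp (-t)` with `t` of
order `√(μ / L)`. -/
lemma exists_contraction {κ₀ μ L : ℝ} (hκ₀ : 1 < κ₀) (hμ : 0 < μ) (hL : κ₀ * μ ≤ L)
    {n s d : ℕ} (hn : 0 < n) (hns : n ≤ 5 * s) (hd : 1 ≤ d) :
    ∃ t : ℝ, 0 < t ∧ t * √(L / μ) ≤ √(30 * κ₀ / (κ₀ - 1)) ∧
      (L - μ) * s * d * (1 - Real.exp (-t)) ^ 2 =
        2 * n * μ * (∑ j, pathWeight d j ^ 2) * Real.exp (-t) := by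
  set S := ∑ j, pathWeight d j ^ 2 with hS
  have hS3 : S ≤ 3 * d := sum_pathWeight_sq_le hd
  have hS0 : 0 < S := Finset.sum_pos
    (fun j _ => pow_pos (zero_lt_one.trans_le (one_le_pathWeight hd j)) 2) Finset.univ_nonempty
  have hn' : (0 : ℝ) < n := by exact_mod_cast hn
  have hs' : (0 : ℝ) < s := by exact_mod_cast (by omega : 0 < s)
  have hns' : (n : ℝ) ≤ 5 * s := by exact_mod_cast hns
  have hd' : (0 : ℝ) < d := by exact_mod_cast hd
  have hκ : 0 < κ₀ - 1 := by linarith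
  have hLμ : 0 < L - μ := by nlinarith
  have hL0 : 0 < L := by linarith
  obtain ⟨t, ht0, htθ, ht⟩ := exists_rate
    (θ := 2 * n * μ * S / ((L - μ) * s * d)) (by positivity)
  refine ⟨t, ht0, ?_, ?_⟩
  -- Here `30 = 2 * 5 * 3`, from `n ≤ 5 s` and `S ≤ 3 d`.
  · have h1 : 2 * n * μ * S / ((L - μ) * s * d) ≤ 30 * μ / (L - μ) := by
      rw [div_le_div_iff₀ (by positivity) hLμ]
      have h2 : (n : ℝ) * S ≤ 5 * s * (3 * d) := mul_le_mul hns' hS3 hS0.le (by positivity)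
      have h3 := mul_le_mul_of_nonneg_left h2 (by positivity : 0 ≤ 2 * μ * (L - μ))
      linarith
    have h4 : 30 * μ / (L - μ) * (L / μ) ≤ 30 * κ₀ / (κ₀ - 1) := by
      rw [div_mul_div_comm, div_le_div_iff₀ (by positivity) hκ]
      nlinarith
    refine Real.le_sqrt_of_sq_le ?_
    rw [mul_pow, Real.sq_sqrt (by positivity)]
    exact (mul_le_mul_of_nonneg_right (htθ.trans h1) (by positivity)).trans h4
  · rw [ht]
    field_simp

/-- Used with `l = log (1 / ε)`, a step count `m`, and `(y, a)` equal to `(1, 1)`, `(χW, p)` or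
`(√χA, d)`. The factor `14` is `2 * 7`: the error is squared, and `y ≤ 7 a`. For `l ≤ 0` the claim
is trivial. -/
lemma scaled_bound {K κ t l y a m : ℝ} (hK : 0 < K) (hm : 0 ≤ m) (hy : 0 ≤ y)
    (htκ : t * √κ ≤ K) (hya : y ≤ 7 * a) (hl : l * a ≤ 2 * t * m) :
    1 / (14 * K) * (√κ * l) * y ≤ m := by
  rcases le_or_gt l 0 with h | h
  · refine le_trans ?_ hm
    have h1 : √κ * l ≤ 0 := mul_nonpos_of_nonneg_of_nonpos (Real.sqrt_nonneg _) h
    exact mul_nonpos_of_nonpos_of_nonneg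
      (mul_nonpos_of_nonneg_of_nonpos (by positivity) h1) hy
  · have h1 : √κ * (l * y) ≤ √κ * (7 * (l * a)) :=
      mul_le_mul_of_nonneg_left (by nlinarith) (Real.sqrt_nonneg _)
    have h2 : √κ * (l * a) ≤ √κ * (2 * t * m) := mul_le_mul_of_nonneg_left hl (Real.sqrt_nonneg _)
    have h3 : t * √κ * m ≤ K * m := mul_le_mul_of_nonneg_right htκ hm
    rw [div_mul_eq_mul_div, div_mul_eq_mul_div, div_le_iff₀ (by positivity)]
    linarith

lemma mul_le_of_le_div {l t : ℝ} (ht : 0 ≤ t) {m b : ℕ} (h : l ≤ 2 * t * (m / b : ℕ)) :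
    l * b ≤ 2 * t * m := by
  have h1 : ((m / b : ℕ) : ℝ) * b ≤ m := by exact_mod_cast Nat.div_mul_le_self m b
  nlinarith [mul_le_mul_of_nonneg_right h (Nat.cast_nonneg (α := ℝ) b)]

end Bounds

end DecOpt

end

theorem theorem2 (κ₀ : ℝ) (hκ₀ : 1 < κ₀) :
    ∃ c : ℝ, 0 < c ∧
      ∀ L μ χA lamMin lamMax χW : ℝ, 0 < μ → κ₀ * μ ≤ L → 1 ≤ χA → 0 < lamMin →
        χW = lamMax / lamMin → 3 ≤ χW →
      -- the network: star graphs with cycling centers, and their gossip matrices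
      ∃ (n p : ℕ) (center : ℕ → Fin n) (W : ℕ → Matrix (Fin n) (Fin n) ℝ),
        (∀ j k, center j = center k ↔ j ≡ k [MOD p]) ∧
        (∀ k, DecOpt.IsGossipMatrix (SimpleGraph.starGraph (center k)) (W k)) ∧
        (∀ k, ∃ l₁ l₂ : ℝ, DecOpt.IsLambdaMinPos (Matrix.toLin' (W k)) l₁ ∧
          DecOpt.IsLambdaMax (Matrix.toLin' (W k)) l₂ ∧ lamMin ≤ l₁ ∧ l₂ ≤ lamMax) ∧
        -- the problem, for arbitrary starting points of the agents
        ∀ x0 : Fin n → DecOpt.H, ∃ (P : DecOpt.Problem n) (xs : DecOpt.H),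
          (∀ i, DecOpt.Smooth L (P.f i) ∧ DecOpt.StronglyConvex μ (P.f i)) ∧
          (∃ l₁ l₂ : ℝ, DecOpt.IsLambdaMinPos P.gramA l₁ ∧
            DecOpt.IsLambdaMax P.gramA l₂ ∧ l₂ / l₁ = χA) ∧
          P.IsSolution (fun _ => xs) ∧
          -- the lower bounds, for every algorithm, accuracy and stopping time
          ∀ (act : ℕ → DecOpt.Action) (x : ℕ → Fin n → DecOpt.H),
            DecOpt.IsExecution P (fun r => SimpleGraph.starGraph (center r)) x0 act x →
            ∀ (ε : ℝ) (k : ℕ), 0 < ε → (∀ i, ‖x k i - xs‖ ^ 2 ≤ ε) →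
              c * (√(L / μ) * Real.log (1 / ε)) ≤
                  (DecOpt.numSteps act .localComputation k : ℝ) ∧
              c * (√(L / μ) * Real.log (1 / ε)) * χW ≤
                  (DecOpt.numSteps act .communication k : ℝ) ∧
              c * (√(L / μ) * Real.log (1 / ε)) * √χA ≤
                  (DecOpt.numSteps act .multiplication k : ℝ) := by
  have hκ : 0 < κ₀ - 1 := by linarith
  have hK : 0 < √(30 * κ₀ / (κ₀ - 1)) := by positivity
  refine ⟨1 / (14 * √(30 * κ₀ / (κ₀ - 1))), by positivity, ?_⟩
  intro L μ χA lamMin lamMax χW hμ hL hχA hlam hχW hχW3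
  obtain ⟨d, l₁, l₂, hd, hχd, hl₁, hl, hb⟩ := DecOpt.exists_pathBounds hχA
  have hl₁₂ : l₁ ≤ l₂ := by rwa [← hl, one_le_div hl₁] at hχA
  obtain ⟨n, hn⟩ : ∃ n, n = ⌊χW⌋₊ := ⟨_, rfl⟩
  have hn3 : 3 ≤ n := hn ▸ Nat.le_floor (by exact_mod_cast hχW3)
  have hnχ : (n : ℝ) ≤ χW := hn ▸ Nat.floor_le (by linarith)
  have hχn : χW < n + 1 := hn ▸ Nat.lt_floor_add_one _
  -- Two coupling groups and the relays take about a third of the agents each; for `n ≥ 3` this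
  -- gives `n ≤ 5 s` and `n + 1 ≤ 7 p`.
  obtain ⟨s, hs⟩ : ∃ s, s = n / 3 := ⟨_, rfl⟩
  obtain ⟨p, hp⟩ : ∃ p, n = 2 * s + p := ⟨n - 2 * s, by omega⟩
  have hs0 : 0 < s := by omega
  have hp0 : 0 < p := by omega
  have hpχ : χW ≤ 7 * p := by
    have : (n : ℝ) + 1 ≤ 7 * p := by exact_mod_cast (by omega : n + 1 ≤ 7 * p)
    linarith
  have hμL : μ ≤ L := by nlinarith
  obtain ⟨center, hc⟩ : ∃ center : ℕ → Fin n, ∀ r, (center r : ℕ) = 2 * s + r % p :=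
    ⟨fun r => ⟨2 * s + r % p, by have := Nat.mod_lt r hp0; omega⟩, fun r => rfl⟩
  refine ⟨n, p, center, fun k => DecOpt.starGossip lamMin (center k), fun j k => ?_,
    fun k => DecOpt.isGossipMatrix_starGossip (by omega) hlam _, fun k => ⟨lamMin, n * lamMin,
      DecOpt.isLambdaMinPos_starGossip hn3 hlam _,
      DecOpt.isLambdaMax_starGossip (by omega) hlam _, le_rfl, ?_⟩, fun x0 => ?_⟩
  · rw [Fin.ext_iff, hc, hc, Nat.add_left_cancel_iff]
    rfl
  -- The largest eigenvalue `n * lamMin` is admissible because `n ≤ χW`.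
  · rwa [hχW, le_div_iff₀ hlam] at hnχ
  obtain ⟨V, hV, hVx⟩ := DecOpt.exists_isometricFamily (ι := Fin (d + 1) ⊕ Fin 2) x0
  obtain ⟨t, ht0, htκ, ht⟩ := DecOpt.exists_contraction hκ₀ hμ hL (n := n) (s := s)
    (by omega) (by omega) hd
  have hr0 : 0 < Real.exp (-t) := Real.exp_pos _
  have hr1 : Real.exp (-t) < 1 := Real.exp_lt_one_iff.2 (by linarith)
  refine ⟨DecOpt.hardProblem V n s μ L (DecOpt.linearCoeff n s d μ L (Real.exp (-t))) l₁ l₂,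
    DecOpt.spread V (DecOpt.geometric (Real.exp (-t)) hr0.le hr1), fun i => ⟨?_, ?_⟩,
    ⟨l₁, l₂, (DecOpt.hardProblem_isLambda hV hd (by omega) hl₁ hl₁₂ hb).1,
      (DecOpt.hardProblem_isLambda hV hd (by omega) hl₁ hl₁₂ hb).2, hl⟩,
    DecOpt.hardProblem_isSolution hV hd hp hs0 hμ.le hμL hr0 hr1 ht, ?_⟩
  · exact DecOpt.smooth_quadratic (DecOpt.hessian_symm (DecOpt.couplingProj_symm s i)) _
      (DecOpt.hessian_inner_le (DecOpt.couplingProj_symm s i) (DecOpt.couplingProj_idem hV s i)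
        hμL)
  · exact DecOpt.stronglyConvex_quadratic (DecOpt.hessian_symm (DecOpt.couplingProj_symm s i)) _
      (DecOpt.le_hessian_inner (DecOpt.couplingProj_symm s i) (DecOpt.couplingProj_idem hV s i)
        hμL)
  intro act x hx ε k _ hεk
  -- The error of agent `0` alone, at vertex `0`, already gives all three bounds.
  have hmem := DecOpt.memory_hardProblem_le hV hp hμ hμL hl₁.le (hl₁.le.trans hl₁₂) hc hVx act k
    ⟨0, by omega⟩ (hx k _)
  have hlog : ∀ m : ℕ, (m + 1, (0 : Fin (d + 1))) ∉ DecOpt.reachable d s p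
      (DecOpt.numSteps act .localComputation k) (DecOpt.numSteps act .multiplication k)
      (DecOpt.numSteps act .communication k) 0 → Real.log (1 / ε) ≤ 2 * t * m := fun m hm =>
    DecOpt.log_inv_le_of_geometric_sq_le hr0.le hr1
      ((DecOpt.sq_le_norm_sub_spread_sq hV hd hmem hm _).trans (hεk _))
  have hloc := hlog (DecOpt.numSteps act .localComputation k) fun h => by
    have := h.1
    simp only at this
    omega
  -- Coordinate `m + 1` costs at least `(m + 1) * p` communications, which exceeds the count for `m`
  -- the integer quotient.
  have hcomm := hlog (DecOpt.numSteps act .communication k / p) fun h => by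
    have := (DecOpt.commCost_lower _ _ _ _).trans h.2.2
    rw [← Nat.le_div_iff_mul_le hp0] at this
    simp only at this
    omega
  have hmult := hlog (DecOpt.numSteps act .multiplication k / d) fun h => by
    have := (Nat.le_add_right _ _).trans h.2.1
    rw [← Nat.le_div_iff_mul_le (by omega)] at this
    simp only at this
    omega
  refine ⟨?_, ?_, ?_⟩
  · rw [← mul_one (Real.log (1 / ε))] at hloc
    rw [← mul_one (1 / _ * _)]
    exact DecOpt.scaled_bound hK (Nat.cast_nonneg _) zero_le_one htκ (by norm_num) hloc
  · exact DecOpt.scaled_bound hK (Nat.cast_nonneg _) (by linarith) htκ hpχ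
      (DecOpt.mul_le_of_le_div ht0.le hcomm)
  · exact DecOpt.scaled_bound hK (Nat.cast_nonneg _) (Real.sqrt_nonneg _) htκ hχd
      (DecOpt.mul_le_of_le_div ht0.le hmult)
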